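/- A temporal graph $\mathcal G=(G_1,\dots,G_T)$, $T\ge 1$, is a finite sequence of simple graphs (its snapshots) on a common finite vertex set $V$; let $n=|V|$. A temporal vertex is a pair $(v,i)\in V\times\{1,\dots,T\}$. For integers $k\ge 1$ and $\ell\ge 0$, a $k$-activity $\ell$-timeline of $\mathcal G$ is a set $\mathcal T$ of triples $(v,a,b)\in V\times\{1,\dots,T\}^2$ with $a\le b$ and $b-a\le \ell$ that contains at most $k$ triples for each vertex $v$. A vertex $u$ is active at time $i$ if there is some $(u,a,b)\in\mathcal T$ with $a\le i\le b$. The timeline $\mathcal T$ dominates $(v,i)$ if $v$ or a neighbor of $v$ in $G_i$ is active at time $i$. The problem Timeline Partial Dominating Set asks, given a temporal graph $\mathcal G$ and integers $k\ge 1$, $\ell\ge 0$, $t\ge 0$, whether there is a $k$-activity $\ell$-timeline of $\mathcal G$ that dominates at least $t$ temporal vertices. Theorem. Timeline Partial Dominating Set is solvable deterministically in $2^{O(t)}\cdot (n+T)^{O(1)}$ time. That is, there are a single program and a constant $c$ such that, on every instance $(\mathcal G,k,\ell,t)$, the program halts after at most $c\cdot 2^{c t}\cdot (n+T)^{c}$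 steps with the correct answer. Here time is the number of steps of a deterministic unit-cost random access machine with addition and truncated subtraction as its only arithmetic operations, whose memory cells hold natural numbers, and whose input consists of the numbers $n,T,k,\ell,t$, one memory cell each, followed by the adjacency matrices of the $T$ snapshots, one entry per cell. -/

import Mathlib

/-! ### Temporal graphs and timelines -/

/-- A temporal graph with vertex set `V` and lifetime `T`: a sequence of `T` (simple, undirected)
graphs, the snapshots, on the same vertex set. Time steps are numbered `0, …, T - 1`. -/
abbrev TemporalGraph (V : Type*) (T : ℕ) := Fin T → SimpleGraph V

/-- `𝒯` is a `k`-activity `ℓ`-timeline: a set of activity intervals `(v, a, b)` with `a ≤ b`,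
at most `k` of them for each vertex, each of length `b - a` at most `ℓ`. -/
def IsTimeline {V : Type*} {T : ℕ} (k ℓ : ℕ) (𝒯 : Set (V × Fin T × Fin T)) : Prop :=
  (∀ v a b, (v, a, b) ∈ 𝒯 → a ≤ b ∧ (b : ℕ) - (a : ℕ) ≤ ℓ) ∧
  ∀ v, {I : Fin T × Fin T | (v, I.1, I.2) ∈ 𝒯}.ncard ≤ k

/-- The set of vertices that are active at time step `i`. -/
def activeSet {V : Type*} {T : ℕ} (𝒯 : Set (V × Fin T × Fin T)) (i : Fin T) : Set V :=
  {u | ∃ a b, (u, a, b) ∈ 𝒯 ∧ a ≤ i ∧ i ≤ b}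

/-- The closed neighborhood `N_G[S]` of a set `S` of vertices. -/
def closedNeighborhood {V : Type*} (G : SimpleGraph V) (S : Set V) : Set V :=
  {v | ∃ s ∈ S, v = s ∨ G.Adj s v}

/-- The set of temporal vertices `(v, i)` that are dominated by `𝒯`. -/
def dominatedSet {V : Type*} {T : ℕ} (𝒢 : TemporalGraph V T) (𝒯 : Set (V × Fin T × Fin T)) :
    Set (V × Fin T) :=
  {x | x.1 ∈ closedNeighborhood (𝒢 x.2) (activeSet 𝒯 x.2)}

/-- An instance of Timeline Partial Dominating Set; the vertices are numbered `0, …, n - 1`. -/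
structure PDSInstance where
  n : ℕ
  T : ℕ
  k : ℕ
  ℓ : ℕ
  t : ℕ
  graph : TemporalGraph (Fin n) T
  one_le_T : 1 ≤ T
  one_le_k : 1 ≤ k

/-- The question of Timeline Partial Dominating Set: is there a `k`-activity `ℓ`-timeline that
dominates at least `t` temporal vertices? -/
def PDSInstance.IsYes (I : PDSInstance) : Prop :=
  ∃ 𝒯 : Set (Fin I.n × Fin I.T × Fin I.T),
    IsTimeline I.k I.ℓ 𝒯 ∧ I.t ≤ (dominatedSet I.graph 𝒯).ncard

/-! ### Random access machines

The deterministic unit-cost random access machine. Its memory consists of cells `0, 1, 2, …`, each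
holding a natural number. The only arithmetic is addition and (truncated) subtraction, so that
this machine and a multi-tape Turing machine simulate each other with polynomial overhead. -/

/-- The instructions; write `M[x]` for the content of cell `x`. -/
inductive RAMInstr where
  /-- `M[d] := c` -/
  | const (d c : ℕ)
  /-- `M[d] := M[a]` -/
  | copy (d a : ℕ)
  /-- `M[d] := M[a] + M[b]` -/
  | add (d a b : ℕ)
  /-- `M[d] := max (M[a] - M[b]) 0` -/
  | sub (d a b : ℕ)
  /-- `M[d] := M[M[a]]` -/
  | load (d a : ℕ)
  /-- `M[M[d]] := M[a]` -/
  | store (d a : ℕ)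
  /-- continue with instruction number `l` -/
  | jump (l : ℕ)
  /-- continue with instruction number `l` if `M[a] = 0`, and with the next one otherwise -/
  | jumpZero (a l : ℕ)

/-- A program is a finite list of instructions, numbered `0, 1, 2, …`. -/
abbrev RAMProgram := List RAMInstr

/-- A configuration: the number of the next instruction, and the memory. -/
structure RAMConfig where
  pc : ℕ
  mem : ℕ → ℕ

/-- The effect of a single instruction. -/
def RAMInstr.exec (c : RAMConfig) : RAMInstr → RAMConfig
  | .const d x => ⟨c.pc + 1, Function.update c.mem d x⟩
  | .copy d a => ⟨c.pc + 1, Function.update c.mem d (c.mem a)⟩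
  | .add d a b => ⟨c.pc + 1, Function.update c.mem d (c.mem a + c.mem b)⟩
  | .sub d a b => ⟨c.pc + 1, Function.update c.mem d (c.mem a - c.mem b)⟩
  | .load d a => ⟨c.pc + 1, Function.update c.mem d (c.mem (c.mem a))⟩
  | .store d a => ⟨c.pc + 1, Function.update c.mem (c.mem d) (c.mem a)⟩
  | .jump l => ⟨l, c.mem⟩
  | .jumpZero a l => ⟨if c.mem a = 0 then l else c.pc + 1, c.mem⟩

/-- One step of the program `P`. The machine has halted when there is no instruction with number
`pc`; then nothing changes any more. -/
def RAMProgram.step (P : RAMProgram) (c : RAMConfig) : RAMConfig :=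
  match P[c.pc]? with
  | some i => i.exec c
  | none => c

/-- Started at instruction `0` with memory content `input`, the program `P` halts after at most
`N` steps, and then cell `0` contains `output`. -/
def RAMProgram.HaltsWithin (P : RAMProgram) (input : ℕ → ℕ) (N : ℕ) (output : ℕ) : Prop :=
  ∃ s ≤ N, P.length ≤ (P.step^[s] ⟨0, input⟩).pc ∧ (P.step^[s] ⟨0, input⟩).mem 0 = output

open Classical in
/-- The input memory for an instance: cells `0, …, 4` contain `n, T, k, ℓ, t`; then follow the
adjacency matrices of the `T` snapshots, one after the other and row by row, with entries `0` and
`1`; all the other cells contain `0`. -/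
noncomputable def PDSInstance.encode (I : PDSInstance) : ℕ → ℕ
  | 0 => I.n
  | 1 => I.T
  | 2 => I.k
  | 3 => I.ℓ
  | 4 => I.t
  | m + 5 =>
    if ∃ (i : Fin I.T) (u v : Fin I.n),
      m = (i : ℕ) * (I.n * I.n) + (u : ℕ) * I.n + (v : ℕ) ∧ (I.graph i).Adj u v then 1 else 0

open Classical in
/-- The program `P` decides Timeline Partial Dominating Set within `time I` steps on every
instance `I`: it halts with answer `1` on the yes-instances and with answer `0` on the others. -/
def RAMProgram.DecidesPDSInTime (P : RAMProgram) (time : PDSInstance → ℕ) : Prop :=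
  ∀ I : PDSInstance, P.HaltsWithin I.encode (time I) (if I.IsYes then 1 else 0)

/-! Let `B = k * (ℓ + 1)` (`budget`) be the number of time steps at which one vertex can be active.
If `t > n * T`, the answer is no. If `t ≤ n * T` and `t ≤ n * B`, it is yes: consecutive intervals
keep all vertices active during the first `min T B` steps, and active vertices dominate themselves
(`isYes_of_le_budget`). Otherwise `n * B < t` (`IsHard`). Then a vector of remaining activity times,
one number up to `B` per vertex, takes only `(B + 1) ^ n ≤ 2 ^ (n * B) ≤ 2 ^ t` values
(`IsHard.numStates_le`), so a dynamic program over time can use these vectors as states.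

One number per vertex suffices because activity can be arranged in disjoint blocks of `ℓ + 1` steps:
the quotient by `ℓ + 1` counts the unopened blocks, and the remainder is the time left in the open
one. The number drops in every step, except that it may pause at multiples of `ℓ + 1`. Timelines
give such countdowns (`exists_countdown`), and intervals can be read off an optimal run
(`exists_intervals_of_value`); together this is `isYes_iff_value`.

The code is never written out. `Computes` asserts that polynomial-time code with boundedly many
scratch cells exists, and is closed under arithmetic, bounded loops and branching;
`Computes.overwriting` adds a table. The input leaves no fixed cells free, so the program starts by
packing the first `K` matrix entries, as bits, into the cell of `n`. This is not circular, since the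
bound on scratch cells does not depend on where the heap begins. -/

/-! ### Running code fragments -/

/-- The code fragment `l` occurs in the program `P` from instruction number `b` on. -/
def RAMProgram.At (P : RAMProgram) (b : ℕ) (l : List RAMInstr) : Prop :=
  ∀ j i, l[j]? = some i → P[b + j]? = some i

theorem RAMProgram.At.append {P : RAMProgram} {b : ℕ} {c c' : List RAMInstr}
    (h : P.At b (c ++ c')) : P.At b c ∧ P.At (b + c.length) c' := by
  constructor
  · intro j i hj
    refine h j i ?_
    rw [List.getElem?_append_left (List.getElem?_eq_some_iff.1 hj).1]
    exact hj
  · intro j i hj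
    rw [add_assoc]
    refine h _ i ?_
    rw [List.getElem?_append_right (by omega)]
    simpa using hj

theorem RAMProgram.At.cons {P : RAMProgram} {b : ℕ} {i : RAMInstr} {c : List RAMInstr}
    (h : P.At b (i :: c)) : P[b]? = some i ∧ P.At (b + 1) c := by
  refine ⟨h 0 i rfl, fun j i' hj => ?_⟩
  have := h (j + 1) i' (by simpa using hj)
  rwa [show b + 1 + j = b + (j + 1) by omega]

theorem RAMProgram.step_eq {P : RAMProgram} {b : ℕ} {i : RAMInstr} (h : P[b]? = some i)
    (mem : ℕ → ℕ) : P.step ⟨b, mem⟩ = i.exec ⟨b, mem⟩ := by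
  simp [RAMProgram.step, h]

theorem RAMProgram.iterate_step_trans {P : RAMProgram} {a b : ℕ} {c c' c'' : RAMConfig}
    (h : P.step^[a] c = c') (h' : P.step^[b] c' = c'') : P.step^[a + b] c = c'' := by
  rw [add_comm, Function.iterate_add_apply, h, h']

/-! ### Functions computable by code fragments -/

/-- A view of the memory of the machine for computations that depend on a parameter `s : γ`.
The first `m` registers hold the values `reg s i`, and the cells from number `rad s` on hold
`heap s`. Running times are measured by `size s`. -/
structure View (γ : Type) where
  size : γ → ℕ
  rad : γ → ℕ
  m : ℕ
  reg : γ → ℕ → ℕ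
  heap : γ → ℕ → ℕ
  two_le_size : ∀ s, 2 ≤ size s

namespace View

variable {γ : Type}

/-- The memory `mem` is as the view `V` says at `s`, with register number `i` in cell `ρ i`. -/
structure Holds (V : View γ) (R : ℕ) (ρ : ℕ → ℕ) (s : γ) (mem : ℕ → ℕ) : Prop where
  rad : V.rad s = R
  reg : ∀ i < V.m, mem (ρ i) = V.reg s i
  heap : ∀ j, mem (R + j) = V.heap s j

theorem Holds.of_eq {V : View γ} {R d : ℕ} {ρ : ℕ → ℕ} {s : γ} {mem mem' : ℕ → ℕ}
    (h : V.Holds R ρ s mem) (hρ : ∀ i < V.m, ρ i < d)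
    (hm : ∀ x, x < d ∨ R ≤ x → mem' x = mem x) : V.Holds R ρ s mem' :=
  ⟨h.rad, fun i hi => by rw [hm _ (Or.inl (hρ i hi)), h.reg i hi],
    fun j => by rw [hm _ (Or.inr (by omega)), h.heap j]⟩

/-- The code fragment `code b`, placed at `b`, computes `f s` into cell `d` in at most
`size s ^ e` steps, and changes no cell outside of the interval `[d, R)`. -/
def Evals (V : View γ) (f : γ → ℕ) (R d : ℕ) (ρ : ℕ → ℕ) (len e : ℕ)
    (code : ℕ → List RAMInstr) : Prop :=
  (∀ b, (code b).length = len) ∧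
  ∀ (P : RAMProgram) (b : ℕ) (s : γ) (mem : ℕ → ℕ), P.At b (code b) → V.Holds R ρ s mem →
    ∃ t mem', t ≤ V.size s ^ e ∧ P.step^[t] ⟨b, mem⟩ = ⟨b + len, mem'⟩ ∧ mem' d = f s ∧
      ∀ x, x < d ∨ R ≤ x → mem' x = mem x

/-- The function `f` can be computed by a code fragment in time polynomial in the size, with a
bounded number of additional registers. -/
def Computes (V : View γ) (f : γ → ℕ) : Prop :=
  ∃ h, ∀ R d ρ, (∀ i < V.m, ρ i < d) → d + h ≤ R → ∃ len e code, V.Evals f R d ρ len e code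

/-- The function `f` is polynomially bounded in the size. -/
def PolyBounded (V : View γ) (f : γ → ℕ) : Prop := ∃ e, ∀ s, f s ≤ V.size s ^ e

theorem Computes.congr {V : View γ} {f g : γ → ℕ} (hf : V.Computes f) (h : ∀ s, f s = g s) :
    V.Computes g := by
  rwa [← funext h]

theorem computes_of_instr (V : View γ) (f : γ → ℕ) (i : ℕ → ℕ → (ℕ → ℕ) → RAMInstr)
    (hi : ∀ R d ρ s mem b, V.Holds R ρ s mem →
      (i R d ρ).exec ⟨b, mem⟩ = ⟨b + 1, Function.update mem d (f s)⟩) : V.Computes f := by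
  refine ⟨1, fun R d ρ hρ hd => ⟨1, 0, fun _ => [i R d ρ], fun b => rfl, ?_⟩⟩
  intro P b s mem hP hm
  refine ⟨1, Function.update mem d (f s), by simp, ?_, by simp, ?_⟩
  · rw [Function.iterate_one, RAMProgram.step_eq hP.cons.1, hi R d ρ s mem b hm]
  · intro x hx
    rw [Function.update_of_ne (by omega)]

theorem computes_const (V : View γ) (c : ℕ) : V.Computes (fun _ => c) :=
  V.computes_of_instr _ (fun _ d _ => .const d c) (by intros; rfl)

/-- The heap start `R` is fixed before the code is chosen, so it may appear as a constant in an
instruction. -/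
theorem computes_rad_sub (V : View γ) (c : ℕ) : V.Computes (fun s => V.rad s - c) :=
  V.computes_of_instr _ (fun R d _ => .const d (R - c))
    (by intro R d ρ s mem b h; simp [RAMInstr.exec, h.rad])

theorem computes_reg (V : View γ) {i : ℕ} (hi : i < V.m) : V.Computes (fun s => V.reg s i) :=
  V.computes_of_instr _ (fun _ d ρ => .copy d (ρ i))
    (by intro R d ρ s mem b h; simp [RAMInstr.exec, h.reg i hi])

/-- Running times are kept as single powers of a size at least `2`; this absorbs the costs of
consecutive fragments into one exponent. -/
theorem pow_add_pow_add_le {x a b c : ℕ} (hx : 2 ≤ x) :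
    x ^ a + x ^ b + c ≤ x ^ (a + b + (c + 2)) := by
  have h1 : x ^ a ≤ x ^ (a + b) := Nat.pow_le_pow_right (by omega) (by omega)
  have h2 : x ^ b ≤ x ^ (a + b) := Nat.pow_le_pow_right (by omega) (by omega)
  have h3 : c + 2 ≤ x ^ (c + 2) := by
    calc c + 2 ≤ 2 ^ (c + 2) := Nat.lt_two_pow_self.le
      _ ≤ x ^ (c + 2) := Nat.pow_le_pow_left hx _
  have h4 : 1 ≤ x ^ (a + b) := Nat.one_le_pow _ _ (by omega)
  rw [pow_add x (a + b)]
  nlinarith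

/-- Applying a binary instruction. -/
theorem Computes.binary {V : View γ} {f g k : γ → ℕ} (hf : V.Computes f) (hg : V.Computes g)
    (i : ℕ → ℕ → RAMInstr)
    (hi : ∀ d R s mem b, mem d = f s → mem (d + 1) = g s →
      V.rad s = R → (∀ j, mem (R + j) = V.heap s j) →
      (i d R).exec ⟨b, mem⟩ = ⟨b + 1, Function.update mem d (k s)⟩) :
    V.Computes k := by
  obtain ⟨h₁, hf⟩ := hf
  obtain ⟨h₂, hg⟩ := hg
  refine ⟨h₁ + h₂ + 2, fun R d ρ hρ hd => ?_⟩
  obtain ⟨l₁, e₁, c₁, hl₁, hc₁⟩ := hf R d ρ hρ (by omega)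
  obtain ⟨l₂, e₂, c₂, hl₂, hc₂⟩ := hg R (d + 1) ρ (fun i hi => (hρ i hi).trans (by omega))
    (by omega)
  refine ⟨l₁ + l₂ + 1, e₁ + e₂ + 3, fun b => c₁ b ++ (c₂ (b + l₁) ++ [i d R]),
    fun b => by simp [hl₁, hl₂, add_assoc], ?_⟩
  intro P b s mem hP hm
  obtain ⟨hP1, hP⟩ := hP.append
  rw [hl₁] at hP
  obtain ⟨hP2, hP⟩ := hP.append
  rw [hl₂] at hP
  obtain ⟨t₁, m₁, ht₁, hs₁, hd₁, hx₁⟩ := hc₁ P b s mem hP1 hm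
  have hm₁ := hm.of_eq hρ hx₁
  obtain ⟨t₂, m₂, ht₂, hs₂, hd₂, hx₂⟩ := hc₂ P _ s m₁ hP2 hm₁
  have hy := hi d R s m₂ (b + l₁ + l₂) (by rw [hx₂ d (by omega), hd₁]) hd₂ hm.rad
    (fun j => by rw [hx₂ _ (by omega), hm₁.heap])
  refine ⟨t₁ + t₂ + 1, Function.update m₂ d (k s),
    (Nat.add_le_add_right (Nat.add_le_add ht₁ ht₂) 1).trans
    (pow_add_pow_add_le (V.two_le_size s)), ?_, by simp, ?_⟩
  · refine RAMProgram.iterate_step_trans (RAMProgram.iterate_step_trans hs₁ hs₂) ?_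
    rw [Function.iterate_one, RAMProgram.step_eq hP.cons.1, hy]
    simp only [add_assoc]
  · intro x hx
    rw [Function.update_of_ne (by omega), hx₂ x (by omega),
      hx₁ x (by omega)]

theorem Computes.add {V : View γ} {f g : γ → ℕ} (hf : V.Computes f) (hg : V.Computes g) :
    V.Computes (fun s => f s + g s) :=
  hf.binary hg (fun d _ => .add d d (d + 1)) (by
    intro d R s mem b h₁ h₂ _ _
    simp [RAMInstr.exec, h₁, h₂])

theorem Computes.sub {V : View γ} {f g : γ → ℕ} (hf : V.Computes f) (hg : V.Computes g) :
    V.Computes (fun s => f s - g s) :=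
  hf.binary hg (fun d _ => .sub d d (d + 1)) (by
    intro d R s mem b h₁ h₂ _ _
    simp [RAMInstr.exec, h₁, h₂])

theorem Computes.heap {V : View γ} {f : γ → ℕ} (hf : V.Computes f) :
    V.Computes (fun s => V.heap s (f s)) := by
  -- Heap positions are relative to `R`, machine addresses are absolute.
  have h : V.Computes (fun s => V.rad s - 0 + f s) := (V.computes_rad_sub 0).add hf
  refine h.binary (V.computes_const 0) (fun d _ => .load d d) ?_
  intro d R s mem b h₁ h₂ h₃ h₄
  simp [RAMInstr.exec, h₁, h₃, h₄]

/-- Computability in a view carries over to a view with more registers. -/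
theorem Computes.comap {γ' : Type} {V : View γ} {V' : View γ'} {f : γ → ℕ} (hf : V.Computes f)
    (φ : γ' → γ) (hm : V.m ≤ V'.m) (hreg : ∀ s, ∀ i < V.m, V'.reg s i = V.reg (φ s) i)
    (hheap : ∀ s j, V'.heap s j = V.heap (φ s) j) (hrad : ∀ s, V'.rad s = V.rad (φ s))
    (hsize : ∀ s, V'.size s = V.size (φ s)) : V'.Computes (fun s => f (φ s)) := by
  obtain ⟨h, hf⟩ := hf
  refine ⟨h, fun R d ρ hρ hd => ?_⟩
  obtain ⟨l, e, c, hl, hc⟩ := hf R d ρ (fun i hi => hρ i (hi.trans_le hm)) hd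
  refine ⟨l, e, c, hl, fun P b s mem hP hmem => ?_⟩
  rw [hsize]
  refine hc P b (φ s) mem hP ⟨(hrad s).symm.trans hmem.rad, fun i hi => ?_, fun j => ?_⟩
  · rw [hmem.reg i (hi.trans_le hm), hreg s i hi]
  · rw [hmem.heap, hheap]

/-! ### Loops -/

/-- The view in the body of a loop with `N s` rounds: two more registers hold the number `i` of
the round and `A s i`. -/
def loop (V : View γ) (N : γ → ℕ) (A : γ → ℕ → ℕ) : View ((s : γ) × Fin (N s)) where
  size s := V.size s.1
  rad s := V.rad s.1
  m := V.m + 2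
  reg s i := if i = V.m then s.2 else if i = V.m + 1 then A s.1 s.2 else V.reg s.1 i
  heap s := V.heap s.1
  two_le_size s := V.two_le_size s.1

theorem Computes.loop {V : View γ} {f : γ → ℕ} (hf : V.Computes f) (N : γ → ℕ)
    (A : γ → ℕ → ℕ) : (V.loop N A).Computes (fun s => f s.1) :=
  hf.comap (fun s : (s : γ) × Fin (N s) => s.1) (by simp [View.loop])
    (fun s i hi => by simp [View.loop, show i ≠ V.m by omega, show i ≠ V.m + 1 by omega])
    (fun _ _ => rfl) (fun _ => rfl) (fun _ => rfl)

theorem computes_loop_index (V : View γ) (N : γ → ℕ) (A : γ → ℕ → ℕ) :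
    (V.loop N A).Computes (fun s => s.2) :=
  ((V.loop N A).computes_reg (i := V.m) (by simp [View.loop])).congr
    (fun s => by simp [View.loop])

theorem computes_loop_acc (V : View γ) (N : γ → ℕ) (A : γ → ℕ → ℕ) :
    (V.loop N A).Computes (fun s => A s.1 s.2) :=
  ((V.loop N A).computes_reg (i := V.m + 1) (by simp [View.loop])).congr
    (fun s => by simp [View.loop])

/-- Both summands `8` are generous allowances for control instructions, one per round and one for
entering and leaving the loop. -/
theorem loop_time_le {x a b c e n t₀ t₁ t₂ : ℕ} (hx : 2 ≤ x) (h₀ : t₀ ≤ x ^ a) (h₁ : t₁ ≤ x ^ b)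
    (h₂ : t₂ ≤ n * (x ^ c + 8)) (hn : n ≤ x ^ e) :
    t₀ + t₁ + t₂ + 8 ≤ x ^ (a + b + (c + 4 + e) + 6) := by
  have h3 : x ^ c + 8 ≤ x ^ (c + 4) := by
    have : 1 ≤ x ^ c := Nat.one_le_pow _ _ (by omega)
    have : 2 ^ 4 ≤ x ^ 4 := Nat.pow_le_pow_left hx _
    rw [pow_add]
    nlinarith
  have h4 : t₂ ≤ x ^ (c + 4 + e) := by
    calc t₂ ≤ n * (x ^ c + 8) := h₂
      _ ≤ x ^ e * x ^ (c + 4) := Nat.mul_le_mul hn h3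
      _ = _ := by rw [← pow_add, add_comm]
  have ha : x ^ a ≤ x ^ (a + b + (c + 4 + e)) := Nat.pow_le_pow_right (by omega) (by omega)
  have hb : x ^ b ≤ x ^ (a + b + (c + 4 + e)) := Nat.pow_le_pow_right (by omega) (by omega)
  have hc : x ^ (c + 4 + e) ≤ x ^ (a + b + (c + 4 + e)) :=
    Nat.pow_le_pow_right (by omega) (by omega)
  have h6 : 2 ^ 6 ≤ x ^ 6 := Nat.pow_le_pow_left hx _
  have h7 : 1 ≤ x ^ (a + b + (c + 4 + e)) := Nat.one_le_pow _ _ (by omega)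
  rw [pow_add x (a + b + (c + 4 + e)) 6]
  nlinarith

/-- Loops: the values `A s 0, …, A s (N s)` can be computed one from the other. -/
theorem Computes.fold {V : View γ} {N : γ → ℕ} {A : γ → ℕ → ℕ} (hN : V.Computes N)
    (pN : V.PolyBounded N) (h0 : V.Computes (fun s => A s 0))
    (hA : (V.loop N A).Computes (fun s => A s.1 (s.2 + 1))) :
    V.Computes (fun s => A s (N s)) := by
  obtain ⟨h₁, hN⟩ := hN
  obtain ⟨h₂, h0⟩ := h0
  obtain ⟨h₃, hA⟩ := hA
  obtain ⟨e, pN⟩ := pN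
  refine ⟨h₁ + h₂ + h₃ + 4, fun R d ρ hρ hd => ?_⟩
  -- Cell `d` is the accumulator, `d + 1` the round number and `d + 2` the number of rounds left;
  -- the body works from `d + 3` on.
  let ρ' : ℕ → ℕ := fun i => if i = V.m then d + 1 else if i = V.m + 1 then d else ρ i
  obtain ⟨l₁, e₁, c₁, hl₁, hc₁⟩ := h0 R d ρ hρ (by omega)
  obtain ⟨l₂, e₂, c₂, hl₂, hc₂⟩ := hN R (d + 2) ρ (fun i hi => (hρ i hi).trans (by omega))
    (by omega)
  obtain ⟨l₃, e₃, c₃, hl₃, hc₃⟩ := hA R (d + 3) ρ' (fun i hi => by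
    have hi : i < V.m + 2 := hi
    simp only [ρ']
    split_ifs
    · omega
    · omega
    · exact (hρ i (by omega)).trans (by omega)) (by omega)
  refine ⟨l₁ + l₂ + 2 + l₃ + 5, e₁ + e₂ + (e₃ + 4 + e) + 6, fun b => c₁ b ++ (c₂ (b + l₁) ++
    (.const (d + 1) 0 :: .jumpZero (d + 2) (b + (l₁ + l₂ + 2 + l₃ + 5)) ::
      (c₃ (b + l₁ + l₂ + 1 + 1) ++ [.copy d (d + 3), .const (d + 3) 1, .add (d + 1) (d + 1) (d + 3),
        .sub (d + 2) (d + 2) (d + 3), .jump (b + l₁ + l₂ + 1)]))),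
    fun b => by simp [hl₁, hl₂, hl₃]; omega, ?_⟩
  intro P b s mem hP hm
  obtain ⟨hP1, hP⟩ := hP.append
  rw [hl₁] at hP
  obtain ⟨hP2, hP⟩ := hP.append
  rw [hl₂] at hP
  obtain ⟨hP3, hP⟩ := hP.cons
  obtain ⟨hP4, hP⟩ := hP.cons
  obtain ⟨hP5, hP⟩ := hP.append
  rw [hl₃] at hP
  obtain ⟨hP6, hP⟩ := hP.cons
  obtain ⟨hP7, hP⟩ := hP.cons
  obtain ⟨hP8, hP⟩ := hP.cons
  obtain ⟨hP9, hP⟩ := hP.cons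
  obtain ⟨hP10, -⟩ := hP.cons
  obtain ⟨t₁, m₁, ht₁, hs₁, hd₁, hx₁⟩ := hc₁ P b s mem hP1 hm
  have hm₁ := hm.of_eq hρ hx₁
  obtain ⟨t₂, m₂, ht₂, hs₂, hd₂, hx₂⟩ := hc₂ P _ s m₁ hP2 hm₁
  -- the loop invariant
  have key : ∀ i ≤ N s, ∃ t m', t ≤ i * (V.size s ^ e₃ + 8) ∧
      P.step^[t] ⟨b + l₁ + l₂ + 1, Function.update m₂ (d + 1) 0⟩ = ⟨b + l₁ + l₂ + 1, m'⟩ ∧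
      m' d = A s i ∧ m' (d + 1) = i ∧ m' (d + 2) = N s - i ∧
      ∀ x, x < d ∨ R ≤ x → m' x = mem x := by
    intro i
    induction i with
    | zero =>
      intro _
      refine ⟨0, _, by simp, rfl, ?_, by simp, ?_, ?_⟩
      · rw [Function.update_of_ne (by omega), hx₂ _ (by omega), hd₁]
      · rw [Function.update_of_ne (by omega), hd₂, Nat.sub_zero]
      · intro x hx
        rw [Function.update_of_ne (by omega), hx₂ _ (by omega), hx₁ _ hx]
    | succ i ih =>
      intro hi
      obtain ⟨t, m', ht, hs, ha, hi', hn, hx⟩ := ih (by omega)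
      have hm' : (V.loop N A).Holds R ρ' ⟨s, ⟨i, hi⟩⟩ m' := by
        have hV := hm.of_eq hρ hx
        refine ⟨hm.rad, fun j hj => ?_, hV.heap⟩
        have hj : j < V.m + 2 := hj
        simp only [ρ', View.loop]
        split_ifs
        · exact hi'
        · exact ha
        · exact hV.reg j (by omega)
      obtain ⟨t₃, m₃, ht₃, hs₃, hd₃, hx₃⟩ := hc₃ P _ _ m' hP5 hm'
      have hjz : P.step ⟨b + l₁ + l₂ + 1, m'⟩ = ⟨b + l₁ + l₂ + 1 + 1, m'⟩ := by
        rw [RAMProgram.step_eq hP4]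
        simp [RAMInstr.exec, hn, show N s - i ≠ 0 by omega]
      refine ⟨t + (1 + t₃ + 5), Function.update (Function.update (Function.update (Function.update
        m₃ d (A s (i + 1))) (d + 3) 1) (d + 1) (i + 1)) (d + 2) (N s - (i + 1)),
        ?_, ?_, ?_, ?_, ?_, ?_⟩
      · have : t₃ ≤ V.size s ^ e₃ := ht₃
        rw [Nat.succ_mul]
        omega
      · refine RAMProgram.iterate_step_trans hs (RAMProgram.iterate_step_trans
          (RAMProgram.iterate_step_trans (Function.iterate_one _ ▸ hjz) hs₃) ?_)
        have e1 : m₃ (d + 1) = i := by rw [hx₃ _ (by omega), hi']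
        have e2 : m₃ (d + 2) = N s - i := by rw [hx₃ _ (by omega), hn]
        simp only [Function.iterate_succ, Function.iterate_zero, Function.comp_apply, id]
        rw [RAMProgram.step_eq hP6]
        simp only [RAMInstr.exec, hd₃]
        rw [RAMProgram.step_eq hP7]
        simp only [RAMInstr.exec]
        rw [RAMProgram.step_eq hP8]
        simp only [RAMInstr.exec]
        rw [RAMProgram.step_eq hP9]
        simp only [RAMInstr.exec]
        rw [RAMProgram.step_eq hP10]
        simp only [RAMInstr.exec]
        simp [e1, e2, Nat.sub_sub]
      · simp
      · simp
      · simp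
      · intro x hx'
        rw [Function.update_of_ne (by omega), Function.update_of_ne (by omega),
          Function.update_of_ne (by omega), Function.update_of_ne (by omega),
          hx₃ x (by omega), hx x hx']
  obtain ⟨t, m', ht, hs, ha, hi', hn, hx⟩ := key (N s) le_rfl
  refine ⟨t₁ + t₂ + (1 + t + 1), m',
    (by omega : _ ≤ t₁ + t₂ + t + 8).trans (loop_time_le (V.two_le_size s) ht₁ ht₂ ht (pN s)),
    ?_, ha, hx⟩
  refine RAMProgram.iterate_step_trans (RAMProgram.iterate_step_trans hs₁ hs₂)
    (RAMProgram.iterate_step_trans (RAMProgram.iterate_step_trans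
      (c' := ⟨b + l₁ + l₂ + 1, Function.update m₂ (d + 1) 0⟩) ?_ hs) ?_)
  · rw [Function.iterate_one, RAMProgram.step_eq hP3]
    rfl
  · rw [Function.iterate_one, RAMProgram.step_eq hP4]
    simp [RAMInstr.exec, hn]

/-! ### Tables on the heap -/

/-- The view after the values `tab s 0, …, tab s (N s - 1)` have been written to the heap from
position `base s` on. -/
def withTable (V : View γ) (base : γ → ℕ) (tab : γ → ℕ → ℕ) (N : γ → ℕ) : View γ where
  __ := V
  heap s j := if base s ≤ j ∧ j < base s + N s then tab s (j - base s) else V.heap s j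

/-- The function `f` can be computed in polynomial time by a code fragment that may change the
heap. -/
def ComputesOverwriting (V : View γ) (f : γ → ℕ) : Prop :=
  ∃ h, ∀ R d ρ, (∀ i < V.m, ρ i < d) → d + h ≤ R → ∃ (len e : ℕ) (code : ℕ → List RAMInstr),
    (∀ b, (code b).length = len) ∧
    ∀ (P : RAMProgram) (b : ℕ) (s : γ) (mem : ℕ → ℕ), P.At b (code b) → V.Holds R ρ s mem →
      ∃ t mem', t ≤ V.size s ^ e ∧ P.step^[t] ⟨b, mem⟩ = ⟨b + len, mem'⟩ ∧ mem' d = f s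

/-- Filling a table, where every entry is computed from the previous ones, before computing `f`. -/
theorem Computes.overwriting {V : View γ} {N base f : γ → ℕ} {tab : γ → ℕ → ℕ}
    (hN : V.Computes N) (pN : V.PolyBounded N) (hbase : V.Computes base)
    (htab : ((V.loop N (fun _ i => i)).withTable (fun s => base s.1) (fun s => tab s.1)
      (fun s => s.2)).Computes (fun s => tab s.1 s.2))
    (hf : (V.withTable base tab N).Computes f) : V.ComputesOverwriting f := by
  obtain ⟨h₁, hN⟩ := hN
  obtain ⟨h₂, hbase⟩ := (V.computes_rad_sub 0).add hbase
  obtain ⟨h₃, htab⟩ := htab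
  obtain ⟨h₄, hf⟩ := hf
  obtain ⟨e, pN⟩ := pN
  refine ⟨h₁ + h₂ + h₃ + h₄ + 4, fun R d ρ hρ hd => ?_⟩
  -- The accumulator of this loop view is the round number itself, so both registers share cell `d +
  -- 1`. Cell `d` counts the rounds left, and `d + 2` holds the address of the next entry.
  let ρ' : ℕ → ℕ := fun i => if i = V.m then d + 1 else if i = V.m + 1 then d + 1 else ρ i
  obtain ⟨l₁, e₁, c₁, hl₁, hc₁⟩ := hN R d ρ hρ (by omega)
  obtain ⟨l₂, e₂, c₂, hl₂, hc₂⟩ := hbase R (d + 2) ρ (fun i hi => (hρ i hi).trans (by omega))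
    (by omega)
  obtain ⟨l₃, e₃, c₃, hl₃, hc₃⟩ := htab R (d + 3) ρ' (fun i hi => by
    have hi : i < V.m + 2 := hi
    simp only [ρ']
    split_ifs
    · omega
    · omega
    · exact (hρ i (by omega)).trans (by omega)) (by omega)
  obtain ⟨l₄, e₄, c₄, hl₄, hc₄⟩ := hf R d ρ hρ (by omega)
  refine ⟨l₁ + l₂ + 2 + l₃ + 6 + l₄, (e₁ + e₂ + (e₃ + 4 + e) + 6) + e₄ + (0 + 2),
    fun b => c₁ b ++ (c₂ (b + l₁) ++
    (.const (d + 1) 0 :: .jumpZero d (b + (l₁ + l₂ + 2 + l₃ + 6)) ::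
      (c₃ (b + l₁ + l₂ + 1 + 1) ++ (.store (d + 2) (d + 3) :: .const (d + 3) 1 ::
        .add (d + 1) (d + 1) (d + 3) :: .add (d + 2) (d + 2) (d + 3) ::
        .sub d d (d + 3) :: .jump (b + l₁ + l₂ + 1) ::
        c₄ (b + l₁ + l₂ + 1 + 1 + l₃ + 1 + 1 + 1 + 1 + 1 + 1))))),
    fun b => by simp [hl₁, hl₂, hl₃, hl₄]; omega, ?_⟩
  intro P b s mem hP hm
  obtain ⟨hP1, hP⟩ := hP.append
  rw [hl₁] at hP
  obtain ⟨hP2, hP⟩ := hP.append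
  rw [hl₂] at hP
  obtain ⟨hP3, hP⟩ := hP.cons
  obtain ⟨hP4, hP⟩ := hP.cons
  obtain ⟨hP5, hP⟩ := hP.append
  rw [hl₃] at hP
  obtain ⟨hP6, hP⟩ := hP.cons
  obtain ⟨hP7, hP⟩ := hP.cons
  obtain ⟨hP8, hP⟩ := hP.cons
  obtain ⟨hP9, hP⟩ := hP.cons
  obtain ⟨hP10, hP⟩ := hP.cons
  obtain ⟨hP11, hP12⟩ := hP.cons
  obtain ⟨t₁, m₁, ht₁, hs₁, hd₁, hx₁⟩ := hc₁ P b s mem hP1 hm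
  have hm₁ := hm.of_eq hρ hx₁
  obtain ⟨t₂, m₂, ht₂, hs₂, hd₂, hx₂⟩ := hc₂ P _ s m₁ hP2 hm₁
  have key : ∀ i ≤ N s, ∃ t m', t ≤ i * (V.size s ^ e₃ + 8) ∧
      P.step^[t] ⟨b + l₁ + l₂ + 1, Function.update m₂ (d + 1) 0⟩ = ⟨b + l₁ + l₂ + 1, m'⟩ ∧
      m' d = N s - i ∧ m' (d + 1) = i ∧ m' (d + 2) = R + base s + i ∧
      (∀ x < d, m' x = mem x) ∧ (∀ j, m' (R + j) =
        if base s ≤ j ∧ j < base s + i then tab s (j - base s) else V.heap s j) := by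
    intro i
    induction i with
    | zero =>
      intro _
      refine ⟨0, _, by simp, rfl, ?_, by simp, ?_, ?_, ?_⟩
      · rw [Function.update_of_ne (by omega), hx₂ _ (by omega), hd₁, Nat.sub_zero]
      · rw [Function.update_of_ne (by omega), hd₂]
        simp [hm.rad]
      · intro x hx
        rw [Function.update_of_ne (by omega), hx₂ _ (by omega), hx₁ _ (by omega)]
      · intro j
        rw [Function.update_of_ne (by omega), hx₂ _ (by omega), hm₁.heap, if_neg (by omega)]
    | succ i ih =>
      intro hi
      obtain ⟨t, m', ht, hs, hn, hi', ha, hx, hh⟩ := ih (by omega)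
      have hm' : ((V.loop N (fun _ i => i)).withTable (fun s => base s.1) (fun s => tab s.1)
          (fun s => s.2)).Holds R ρ' ⟨s, ⟨i, hi⟩⟩ m' := by
        refine ⟨hm.rad, fun j hj => ?_, hh⟩
        have hj : j < V.m + 2 := hj
        simp only [ρ', View.loop, View.withTable]
        split_ifs
        · exact hi'
        · exact hi'
        · rw [hx _ (hρ j (by omega)), hm.reg j (by omega)]
      obtain ⟨t₃, m₃, ht₃, hs₃, hd₃, hx₃⟩ := hc₃ P _ _ m' hP5 hm'
      have hjz : P.step ⟨b + l₁ + l₂ + 1, m'⟩ = ⟨b + l₁ + l₂ + 1 + 1, m'⟩ := by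
        rw [RAMProgram.step_eq hP4]
        simp [RAMInstr.exec, hn, show N s - i ≠ 0 by omega]
      refine ⟨t + (1 + t₃ + 6), Function.update (Function.update (Function.update (Function.update
        (Function.update m₃ (R + base s + i) (tab s i)) (d + 3) 1) (d + 1) (i + 1)) (d + 2)
        (R + base s + i + 1)) d (N s - (i + 1)), ?_, ?_, ?_, ?_, ?_, ?_, ?_⟩
      · have : t₃ ≤ V.size s ^ e₃ := ht₃
        rw [Nat.succ_mul]
        omega
      · refine RAMProgram.iterate_step_trans hs (RAMProgram.iterate_step_trans
          (RAMProgram.iterate_step_trans (Function.iterate_one _ ▸ hjz) hs₃) ?_)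
        have e1 : m₃ (d + 1) = i := by rw [hx₃ _ (by omega), hi']
        have e2 : m₃ (d + 2) = R + base s + i := by rw [hx₃ _ (by omega), ha]
        have e3 : m₃ d = N s - i := by rw [hx₃ _ (by omega), hn]
        have n0 : d ≠ R + base s + i := by omega
        have n1 : d + 1 ≠ R + base s + i := by omega
        have n2 : d + 2 ≠ R + base s + i := by omega
        simp only [Function.iterate_succ, Function.iterate_zero, Function.comp_apply, id]
        rw [RAMProgram.step_eq hP6]
        simp only [RAMInstr.exec, hd₃, e2]
        rw [RAMProgram.step_eq hP7]
        simp only [RAMInstr.exec]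
        rw [RAMProgram.step_eq hP8]
        simp only [RAMInstr.exec]
        rw [RAMProgram.step_eq hP9]
        simp only [RAMInstr.exec]
        rw [RAMProgram.step_eq hP10]
        simp only [RAMInstr.exec]
        rw [RAMProgram.step_eq hP11]
        simp only [RAMInstr.exec]
        simp [e1, e2, e3, n0, n1, n2, Nat.sub_sub]
      · simp
      · simp
      · simp [add_assoc]
      · intro x hx'
        rw [Function.update_of_ne (by omega), Function.update_of_ne (by omega),
          Function.update_of_ne (by omega), Function.update_of_ne (by omega),
          Function.update_of_ne (by omega), hx₃ x (by omega), hx x hx']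
      · intro j
        rw [Function.update_of_ne (by omega), Function.update_of_ne (by omega),
          Function.update_of_ne (by omega), Function.update_of_ne (by omega)]
        rcases eq_or_ne j (base s + i) with rfl | hj
        · rw [← add_assoc, Function.update_self, if_pos (by omega), Nat.add_sub_cancel_left]
        · rw [Function.update_of_ne (by omega), hx₃ _ (by omega), hh]
          exact if_congr (by omega) rfl rfl
  obtain ⟨t, m', ht, hs, hn, hi', ha, hx, hh⟩ := key (N s) le_rfl
  obtain ⟨t₄, m₄, ht₄, hs₄, hd₄, -⟩ := hc₄ P _ s m' hP12
    ⟨hm.rad, fun j hj => by rw [hx _ (hρ j hj)]; exact hm.reg j hj, hh⟩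
  have hT := loop_time_le (V.two_le_size s) ht₁ ht₂ ht (pN s)
  refine ⟨t₁ + t₂ + (1 + t + 1) + t₄, m₄, (by omega : _ ≤ t₁ + t₂ + t + 8 + t₄ + 0).trans
    ((Nat.add_le_add hT ht₄).trans (pow_add_pow_add_le (c := 0) (V.two_le_size s))), ?_, hd₄⟩
  rw [show b + (l₁ + l₂ + 2 + l₃ + 6 + l₄) = b + l₁ + l₂ + 1 + 1 + l₃ + 1 + 1 + 1 + 1 + 1 + 1 + l₄
    by omega]
  refine RAMProgram.iterate_step_trans (RAMProgram.iterate_step_trans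
    (RAMProgram.iterate_step_trans hs₁ hs₂)
    (RAMProgram.iterate_step_trans (RAMProgram.iterate_step_trans
      (c' := ⟨b + l₁ + l₂ + 1, Function.update m₂ (d + 1) 0⟩) ?_ hs) ?_)) hs₄
  · rw [Function.iterate_one, RAMProgram.step_eq hP3]
    rfl
  · rw [Function.iterate_one, RAMProgram.step_eq hP4]
    simp only [RAMInstr.exec, hn, Nat.sub_self, if_true, RAMConfig.mk.injEq, and_true]
    omega

end View

/-! ### Arithmetic and bounded quantifiers -/

open Classical in
/-- The number `1` if `p` holds, and `0` otherwise. -/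
noncomputable def indicator (p : Prop) : ℕ := if p then 1 else 0

theorem indicator_true {p : Prop} (h : p) : indicator p = 1 := if_pos h

theorem indicator_false {p : Prop} (h : ¬p) : indicator p = 0 := if_neg h

theorem indicator_le_one (p : Prop) : indicator p ≤ 1 := by
  unfold indicator
  split_ifs <;> omega

theorem of_lt_indicator {p : Prop} {i : ℕ} (h : i < indicator p) : p := by
  by_contra hp
  rw [indicator_false hp] at h
  omega

namespace View

variable {γ : Type} {V : View γ}

theorem PolyBounded.of_le {f g : γ → ℕ} (hg : V.PolyBounded g) (h : ∀ s, f s ≤ g s) :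
    V.PolyBounded f :=
  let ⟨e, he⟩ := hg
  ⟨e, fun s => (h s).trans (he s)⟩

theorem polyBounded_const (V : View γ) (c : ℕ) : V.PolyBounded (fun _ => c) :=
  ⟨c, fun s => (Nat.lt_two_pow_self (n := c)).le.trans (Nat.pow_le_pow_left (V.two_le_size s) c)⟩

theorem polyBounded_size (V : View γ) : V.PolyBounded V.size := ⟨1, fun s => by simp⟩

theorem PolyBounded.mul {f g : γ → ℕ} (hf : V.PolyBounded f) (hg : V.PolyBounded g) :
    V.PolyBounded (fun s => f s * g s) := by
  obtain ⟨a, ha⟩ := hf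
  obtain ⟨b, hb⟩ := hg
  exact ⟨a + b, fun s => by rw [pow_add]; exact Nat.mul_le_mul (ha s) (hb s)⟩

theorem PolyBounded.add {f g : γ → ℕ} (hf : V.PolyBounded f) (hg : V.PolyBounded g) :
    V.PolyBounded (fun s => f s + g s) := by
  obtain ⟨a, ha⟩ := hf
  obtain ⟨b, hb⟩ := hg
  exact ⟨a + b + (0 + 2), fun s => (Nat.add_le_add (ha s) (hb s)).trans
    (pow_add_pow_add_le (c := 0) (V.two_le_size s))⟩

theorem PolyBounded.loop {f : γ → ℕ} (hf : V.PolyBounded f) (N : γ → ℕ) (A : γ → ℕ → ℕ) :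
    (V.loop N A).PolyBounded (fun s => f s.1) :=
  let ⟨e, he⟩ := hf
  ⟨e, fun s => he s.1⟩

theorem polyBounded_loop_index {N : γ → ℕ} (hN : V.PolyBounded N) (A : γ → ℕ → ℕ) :
    (V.loop N A).PolyBounded (fun s => s.2) :=
  (hN.loop N A).of_le fun s => s.2.2.le

theorem Computes.sum {N : γ → ℕ} {g : γ → ℕ → ℕ} (hN : V.Computes N) (pN : V.PolyBounded N)
    (hg : ∀ A, (V.loop N A).Computes (fun s => g s.1 s.2)) :
    V.Computes (fun s => ∑ i ∈ Finset.range (N s), g s i) := by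
  refine Computes.fold (A := fun s j => ∑ i ∈ Finset.range j, g s i) hN pN
    ((V.computes_const 0).congr fun s => by simp) ?_
  exact ((V.computes_loop_acc N _).add (hg _)).congr fun s => by rw [Finset.sum_range_succ]

theorem Computes.sup {N : γ → ℕ} {g : γ → ℕ → ℕ} (hN : V.Computes N) (pN : V.PolyBounded N)
    (hg : ∀ A, (V.loop N A).Computes (fun s => g s.1 s.2)) :
    V.Computes (fun s => (Finset.range (N s)).sup (g s)) := by
  refine Computes.fold (A := fun s j => (Finset.range j).sup (g s)) hN pN
    ((V.computes_const 0).congr fun s => by simp) ?_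
  -- With truncated subtraction, `max a b = a + (b - a)`.
  refine ((V.computes_loop_acc N _).add ((hg _).sub (V.computes_loop_acc N _))).congr fun s => ?_
  rw [Finset.range_add_one, Finset.sup_insert]
  omega

/-- Repeated addition: only the first factor is a number of rounds, so the second may be arbitrarily
large. -/
theorem Computes.mul {f g : γ → ℕ} (hf : V.Computes f) (hg : V.Computes g)
    (pf : V.PolyBounded f) : V.Computes (fun s => f s * g s) :=
  (Computes.sum (g := fun s _ => g s) hf pf fun A => hg.loop f A).congr fun s => by simp

theorem Computes.pow {f g : γ → ℕ} (hf : V.Computes f) (hg : V.Computes g)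
    (pf : V.PolyBounded f) (pg : V.PolyBounded g) : V.Computes (fun s => f s ^ g s) := by
  refine Computes.fold (A := fun s j => f s ^ j) hg pg
    ((V.computes_const 1).congr fun s => by simp) ?_
  exact ((hf.loop g _).mul (V.computes_loop_acc g _) (pf.loop g _)).congr
    fun s => by rw [pow_succ, mul_comm]

/-- The property `p` can be decided in polynomial time. -/
def Decides (V : View γ) (p : γ → Prop) : Prop := V.Computes (fun s => indicator (p s))

theorem Decides.congr {p q : γ → Prop} (hp : V.Decides p) (h : ∀ s, p s ↔ q s) : V.Decides q :=
  Computes.congr hp fun s => by rw [h s]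

theorem Computes.le {f g : γ → ℕ} (hf : V.Computes f) (hg : V.Computes g) :
    V.Decides (fun s => f s ≤ g s) :=
  ((V.computes_const 1).sub (hf.sub hg)).congr fun s => by
    unfold indicator
    split_ifs <;> omega

theorem Computes.lt {f g : γ → ℕ} (hf : V.Computes f) (hg : V.Computes g) :
    V.Decides (fun s => f s < g s) :=
  ((hf.add (V.computes_const 1)).le hg).congr fun _ => Iff.rfl

theorem Decides.not {p : γ → Prop} (hp : V.Decides p) : V.Decides (fun s => ¬p s) :=
  ((V.computes_const 1).sub hp).congr fun s => by
    unfold indicator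
    split_ifs <;> simp_all

theorem Decides.and {p q : γ → Prop} (hp : V.Decides p) (hq : V.Decides q) :
    V.Decides (fun s => p s ∧ q s) :=
  ((Computes.add hp hq).sub (V.computes_const 1)).congr fun s => by
    unfold indicator
    split_ifs <;> simp_all

theorem Decides.or {p q : γ → Prop} (hp : V.Decides p) (hq : V.Decides q) :
    V.Decides (fun s => p s ∨ q s) :=
  (hp.not.and hq.not).not.congr fun s => by tauto

theorem Computes.eq {f g : γ → ℕ} (hf : V.Computes f) (hg : V.Computes g) :
    V.Decides (fun s => f s = g s) :=
  ((hf.le hg).and (hg.le hf)).congr fun _ => le_antisymm_iff.symm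

theorem Decides.bex {N : γ → ℕ} {p : γ → ℕ → Prop} (hN : V.Computes N) (pN : V.PolyBounded N)
    (hp : ∀ A, (V.loop N A).Decides (fun s => p s.1 s.2)) :
    V.Decides (fun s => ∃ i < N s, p s i) := by
  refine ((V.computes_const 0).lt (Computes.sum (g := fun s i => indicator (p s i)) hN pN hp)).congr
    fun s => ?_
  rw [Finset.sum_pos_iff]
  refine exists_congr fun i => ?_
  rw [Finset.mem_range]
  exact and_congr_right fun _ => ⟨of_lt_indicator, fun h => by simp [indicator_true h]⟩

theorem Decides.ball {N : γ → ℕ} {p : γ → ℕ → Prop} (hN : V.Computes N) (pN : V.PolyBounded N)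
    (hp : ∀ A, (V.loop N A).Decides (fun s => p s.1 s.2)) :
    V.Decides (fun s => ∀ i < N s, p s i) :=
  (Decides.bex (p := fun s i => ¬p s i) hN pN fun A => (hp A).not).not.congr fun s => by
    push Not
    rfl

/-- A view, restricted to the parameters with property `p`. -/
def restrict (V : View γ) (p : γ → Prop) : View {s // p s} where
  size s := V.size s.1
  rad s := V.rad s.1
  m := V.m
  reg s := V.reg s.1
  heap s := V.heap s.1
  two_le_size s := V.two_le_size s.1

-- A branch is a loop with `indicator (p s)` rounds. Its body runs only if the condition holds, so
-- each branch need only be computable on the restricted view.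
open Classical in
theorem Computes.ite {p : γ → Prop} {f g : γ → ℕ} (hp : V.Decides p)
    (hf : (V.restrict p).Computes (fun s => f s.1))
    (hg : (V.restrict fun s => ¬p s).Computes (fun s => g s.1)) :
    V.Computes (fun s => if p s then f s else g s) := by
  have aux : ∀ (p : γ → Prop) (f : γ → ℕ), V.Decides p →
      (V.restrict p).Computes (fun s => f s.1) → V.Computes (fun s => indicator (p s) * f s) := by
    intro p f hp hf
    refine (Computes.sum (g := fun s _ => f s) hp
      ((V.polyBounded_const 1).of_le fun s => indicator_le_one _) fun A => ?_).congr
      fun s => by simp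
    exact hf.comap (V' := V.loop (fun s => indicator (p s)) A)
      (fun s => ⟨s.1, of_lt_indicator s.2.2⟩) (by simp [View.loop, restrict])
      (fun s i hi => by
        have hi : i < V.m := hi
        simp [View.loop, restrict, show i ≠ V.m by omega, show i ≠ V.m + 1 by omega])
      (fun _ _ => rfl) (fun _ => rfl) (fun _ => rfl)
  refine ((aux p f hp hf).add (aux _ g hp.not hg)).congr fun s => ?_
  unfold indicator
  split_ifs <;> simp_all

theorem Computes.restrict {f : γ → ℕ} (hf : V.Computes f) (p : γ → Prop) :
    (V.restrict p).Computes (fun s => f s.1) :=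
  hf.comap (V' := V.restrict p) (fun s => s.1) le_rfl (fun _ _ _ => rfl) (fun _ _ => rfl)
    (fun _ => rfl) (fun _ => rfl)

theorem PolyBounded.restrict {f : γ → ℕ} (hf : V.PolyBounded f) (p : γ → Prop) :
    (V.restrict p).PolyBounded (fun s => f s.1) :=
  let ⟨e, he⟩ := hf
  ⟨e, fun s => he s.1⟩

/-- The quotient is the number of `i < f s` with `(i + 1) * g s ≤ f s`. -/
theorem Computes.div {f g : γ → ℕ} (hf : V.Computes f) (hg : V.Computes g)
    (pf : V.PolyBounded f) (h0 : ∀ s, 0 < g s) : V.Computes (fun s => f s / g s) := by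
  refine (Computes.sum (g := fun s i => indicator ((i + 1) * g s ≤ f s)) hf pf fun A => ?_).congr
    fun s => ?_
  · have hi := V.computes_loop_index f A
    exact ((hi.add (computes_const _ 1)).mul (hg.loop f A)
      ((polyBounded_loop_index pf A).add (polyBounded_const _ 1))).le (hf.loop f A)
  · have h : ∀ i, indicator ((i + 1) * g s ≤ f s) = if i < f s / g s then 1 else 0 := fun i => by
      rw [← Nat.le_div_iff_mul_le (h0 s)]
      unfold indicator
      split_ifs <;> omega
    have h' : (Finset.range (f s)).filter (fun i => i < f s / g s) = Finset.range (f s / g s) := by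
      ext i
      have := Nat.div_le_self (f s) (g s)
      simp only [Finset.mem_filter, Finset.mem_range]
      omega
    simp only [h]
    rw [← Finset.card_filter, h', Finset.card_range]

theorem Computes.mod {f g : γ → ℕ} (hf : V.Computes f) (hg : V.Computes g)
    (pf : V.PolyBounded f) (h0 : ∀ s, 0 < g s) : V.Computes (fun s => f s % g s) := by
  refine (hf.sub ((hf.div hg pf h0).mul hg (pf.of_le fun s => Nat.div_le_self _ _))).congr
    fun s => ?_
  have := Nat.div_add_mod (f s) (g s)
  rw [mul_comm] at this
  omega

end View

/-! ### Dynamic programming over time -/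

theorem indicator_mono {p q : Prop} (h : p → q) : indicator p ≤ indicator q := by
  by_cases hp : p
  · rw [indicator_true hp, indicator_true (h hp)]
  · rw [indicator_false hp]
    exact Nat.zero_le _

theorem exists_lt_pow_forall_digit_eq {B n : ℕ} (f : ℕ → ℕ) (hf : ∀ v < n, f v < B) :
    ∃ p < B ^ n, ∀ v < n, p / B ^ v % B = f v := by
  let g : Fin n → Fin B := fun v => ⟨f v, hf v v.2⟩
  refine ⟨finFunctionFinEquiv g, (finFunctionFinEquiv g).2, fun v hv => ?_⟩
  have h := congrFun (finFunctionFinEquiv.symm_apply_apply g) ⟨v, hv⟩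
  exact congrArg Fin.val h

/-- When the remaining time drops from `a + 1` to `a`, either a new block of `s` steps is opened
(left) or the running block continues (right). -/
theorem succ_div_mod_cases (a : ℕ) {s : ℕ} (hs : 0 < s) :
    ((a + 1) % s = 0 ∧ (a + 1) / s = a / s + 1 ∧ a % s + 1 = s) ∨
      ((a + 1) % s = a % s + 1 ∧ (a + 1) / s = a / s) := by
  have h1 := Nat.div_add_mod a s
  have h2 := Nat.div_add_mod (a + 1) s
  have h3 := Nat.succ_div (a := a) (b := s)
  have h4 := Nat.mod_lt a hs
  split_ifs at h3 with h
  · left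
    have h5 := Nat.mod_eq_zero_of_dvd h
    rw [h3, mul_add] at h2
    omega
  · right
    have h3 : (a + 1) / s = a / s := h3
    rw [h3] at h2
    omega

/-! ### Activity as a countdown -/

/-- A set that is covered by `k` intervals of `ℓ + 1` time steps can be covered by counting down
from `k * (ℓ + 1)`, with pauses at multiples of `ℓ + 1` only. -/
theorem exists_countdown {k ℓ : ℕ} (F : Finset (ℕ × ℕ)) (hF : F.card ≤ k)
    (hℓ : ∀ x ∈ F, x.2 - x.1 ≤ ℓ) :
    ∃ s : ℕ → ℕ, (∀ i, s i ≤ k * (ℓ + 1)) ∧ ∀ i,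
      (s (i + 1) + 1 = s i ∨ s (i + 1) = s i ∧ s i % (ℓ + 1) = 0) ∧
        ((∃ x ∈ F, x.1 ≤ i ∧ i ≤ x.2) → s (i + 1) ≠ s i) := by
  classical
  -- Greedy choice: a running block must be finished, and a new one is opened only when some
  -- interval of `F` is active.
  let s : ℕ → ℕ := fun i => Nat.rec (k * (ℓ + 1))
    (fun i y => if y % (ℓ + 1) ≠ 0 ∨ ∃ x ∈ F, x.1 ≤ i ∧ i ≤ x.2 then y - 1 else y) i
  have hs : ∀ i, s (i + 1) = if s i % (ℓ + 1) ≠ 0 ∨ ∃ x ∈ F, x.1 ≤ i ∧ i ≤ x.2 then s i - 1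
      else s i := fun i => rfl
  -- The invariant: the intervals that end before the running block does, together with the unopened
  -- blocks, number at least `k`. It excludes exhaustion while an interval is active, because that
  -- interval is missing from the filtered set.
  have pos : ∀ i, k ≤ (F.filter fun x => x.2 < i + s i % (ℓ + 1)).card + s i / (ℓ + 1) →
      (s i % (ℓ + 1) ≠ 0 ∨ ∃ x ∈ F, x.1 ≤ i ∧ i ≤ x.2) → s i ≠ 0 := by
    rintro i hi h h0
    rw [h0] at h hi
    rcases h with h | ⟨x, hx, hx1, hx2⟩
    · simp at h
    · have : (F.filter fun x => x.2 < i + 0 % (ℓ + 1)).card < F.card := by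
        apply Finset.card_lt_card
        rw [Finset.filter_ssubset]
        exact ⟨x, hx, by simpa using hx2⟩
      simp at hi this
      omega
  have inv : ∀ i, k ≤ (F.filter fun x => x.2 < i + s i % (ℓ + 1)).card + s i / (ℓ + 1) := by
    intro i
    induction i with
    | zero =>
      have : s 0 / (ℓ + 1) = k := Nat.mul_div_cancel k (by omega)
      omega
    | succ i ih =>
      have h := hs i
      split_ifs at h with hc
      · obtain ⟨y, hy⟩ := Nat.exists_eq_succ_of_ne_zero (pos i ih hc)
        rw [hy] at ih hc h
        rw [Nat.succ_sub_one] at h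
        rw [h]
        rcases succ_div_mod_cases y (s := ℓ + 1) (by omega) with ⟨h1, h2, h3⟩ | ⟨h1, h2⟩
        -- A block is opened on account of `x`. Since `x.2 - x.1 ≤ ℓ`, the block lasts at least
        -- until `x` ends, so `x` is counted from now on; it was not counted before, being active at
        -- `i`. This makes up for the spent block.
        · rw [Nat.succ_eq_add_one, h1, h2] at ih
          obtain ⟨x, hx, hx1, hx2⟩ := hc.resolve_left (by simpa using h1)
          have : (F.filter fun x => x.2 < i + 0).card
              < (F.filter fun x => x.2 < i + 1 + y % (ℓ + 1)).card := by
            apply Finset.card_lt_card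
            rw [Finset.ssubset_iff_of_subset
              (Finset.monotone_filter_right F fun x _ (hx : x.2 < i + 0) => by omega)]
            have := hℓ x hx
            exact ⟨x, by simp only [Finset.mem_filter]; exact ⟨hx, by omega⟩,
              by simp only [Finset.mem_filter]; omega⟩
          omega
        · rw [Nat.succ_eq_add_one, h1, h2] at ih
          rwa [show i + 1 + y % (ℓ + 1) = i + (y % (ℓ + 1) + 1) by omega]
      · rw [h]
        refine ih.trans (Nat.add_le_add_right (Finset.card_le_card ?_) _)
        exact Finset.monotone_filter_right F fun x _ (hx : x.2 < _) => by omega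
  have step : ∀ i, (s (i + 1) + 1 = s i ∨ s (i + 1) = s i ∧ s i % (ℓ + 1) = 0) ∧
        ((∃ x ∈ F, x.1 ≤ i ∧ i ≤ x.2) → s (i + 1) ≠ s i) := by
    intro i
    have h := hs i
    split_ifs at h with hc
    · have := pos i (inv i) hc
      exact ⟨Or.inl (by omega), fun _ => by omega⟩
    · push Not at hc
      exact ⟨Or.inr ⟨h, hc.1⟩, fun ⟨x, hx, hx1, hx2⟩ => absurd (hc.2 x hx hx1) (by omega)⟩
  refine ⟨s, fun i => ?_, step⟩
  induction i with
  | zero => exact le_rfl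
  | succ i ih =>
    rcases (step i).1 with h | h <;> omega

/-! ### The dynamic program -/

namespace PDSInstance

variable (I : PDSInstance)

/-- The number of time steps at which a vertex can be active. -/
def budget : ℕ := I.k * (I.ℓ + 1)

/-- The number of states. The digits of a state to the base `budget + 1` are the numbers of time
steps at which the vertices can still be active. -/
def numStates : ℕ := (I.budget + 1) ^ I.n

/-- The remaining budget of the vertex `v` in state `p`. -/
def digit (p v : ℕ) : ℕ := p / (I.budget + 1) ^ v % (I.budget + 1)

/-- The entries of the adjacency matrices. -/
noncomputable def adj (i u v : ℕ) : ℕ := I.encode (i * (I.n * I.n) + u * I.n + v + 5)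

/-- The state `q` may follow upon the state `p`. The vertices whose digits change are active. -/
def IsTransition (p q : ℕ) : Prop :=
  ∀ v < I.n, I.digit q v + 1 = I.digit p v ∨ I.digit q v = I.digit p v ∧
    I.digit p v % (I.ℓ + 1) = 0

/-- The number of vertices that are dominated at time `i` by the vertices in `A`. -/
noncomputable def numDominated (i : ℕ) (A : ℕ → Prop) : ℕ :=
  ∑ v ∈ Finset.range I.n, indicator (∃ u < I.n, A u ∧ (u = v ∨ I.adj i u v = 1))

/-- The maximum number of temporal vertices that can be dominated in the last `r` time steps,
starting in state `p`. -/
noncomputable def value : ℕ → ℕ → ℕ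
  | 0, _ => 0
  | r + 1, p => (Finset.range I.numStates).sup fun q => indicator (I.IsTransition p q) *
      (I.numDominated (I.T - (r + 1)) (fun u => I.digit q u ≠ I.digit p u) + value r q)

variable {I}

theorem digit_le (p v : ℕ) : I.digit p v ≤ I.budget :=
  Nat.lt_succ_iff.1 (Nat.mod_lt _ (Nat.succ_pos _))

theorem numDominated_mono {i : ℕ} {A A' : ℕ → Prop} (h : ∀ u < I.n, A u → A' u) :
    I.numDominated i A ≤ I.numDominated i A' :=
  Finset.sum_le_sum fun _ _ => indicator_mono fun ⟨u, hu, hA, hv⟩ => ⟨u, hu, h u hu hA, hv⟩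

theorem encode_add_five (m : ℕ) : I.encode (m + 5) = indicator (∃ (i : Fin I.T) (u v : Fin I.n),
    m = (i : ℕ) * (I.n * I.n) + (u : ℕ) * I.n + (v : ℕ) ∧ (I.graph i).Adj u v) := by
  rw [encode]
  unfold indicator
  split_ifs <;> rfl

/-- The position of an entry is a numeral to the base `n` with low digits `u` and `v`, so it
determines `i`, `u` and `v`. -/
theorem adj_eq_one_iff {i u v : ℕ} (hi : i < I.T) (hu : u < I.n) (hv : v < I.n) :
    I.adj i u v = 1 ↔ (I.graph ⟨i, hi⟩).Adj ⟨u, hu⟩ ⟨v, hv⟩ := by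
  have key : ∀ {a b c a' b' c' : ℕ}, b < I.n → c < I.n → b' < I.n → c' < I.n →
      a * (I.n * I.n) + b * I.n + c = a' * (I.n * I.n) + b' * I.n + c' →
      a = a' ∧ b = b' ∧ c = c' := by
    intro a b c a' b' c' hb hc hb' hc' h
    have h0 : 0 < I.n := by omega
    have e1 : ∀ x y z, x * (I.n * I.n) + y * I.n + z = (x * I.n + y) * I.n + z := by
      intro x y z
      ring
    rw [e1, e1] at h
    have h1 := congrArg (· / I.n) h
    have h2 := congrArg (· % I.n) h
    simp only [Nat.mul_comm _ I.n, Nat.mul_add_div h0, Nat.div_eq_of_lt hc,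
      Nat.div_eq_of_lt hc', Nat.mul_add_mod, Nat.mod_eq_of_lt hc, Nat.mod_eq_of_lt hc'] at h1 h2
    have h3 := congrArg (· / I.n) h1
    have h4 := congrArg (· % I.n) h1
    simp only [Nat.add_zero, Nat.mul_add_div h0, Nat.div_eq_of_lt hb,
      Nat.div_eq_of_lt hb', Nat.mul_add_mod, Nat.mod_eq_of_lt hb, Nat.mod_eq_of_lt hb'] at h3 h4
    exact ⟨h3, h4, h2⟩
  unfold adj
  rw [encode_add_five]
  constructor
  · intro h
    obtain ⟨i', u', v', he, ha⟩ := of_lt_indicator (h ▸ Nat.zero_lt_one)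
    obtain ⟨rfl, rfl, rfl⟩ := key hu hv u'.2 v'.2 he
    exact ha
  · intro h
    exact indicator_true ⟨⟨i, hi⟩, ⟨u, hu⟩, ⟨v, hv⟩, rfl, h⟩

theorem ncard_dominatedSet (𝒯 : Set (Fin I.n × Fin I.T × Fin I.T)) :
    (dominatedSet I.graph 𝒯).ncard = ∑ i ∈ Finset.range I.T, I.numDominated i
      (fun u => ∃ (hu : u < I.n) (hi : i < I.T), ⟨u, hu⟩ ∈ activeSet 𝒯 ⟨i, hi⟩) := by
  classical
  have h1 : (dominatedSet I.graph 𝒯).ncard = ∑ x, indicator (x ∈ dominatedSet I.graph 𝒯) := by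
    unfold indicator
    rw [← Finset.card_filter, Set.ncard_eq_toFinset_card']
    congr 1
    ext x
    simp
  rw [h1, Fintype.sum_prod_type_right, Finset.sum_range]
  refine Finset.sum_congr rfl fun i _ => ?_
  unfold numDominated
  rw [Finset.sum_range]
  refine Finset.sum_congr rfl fun v _ => congrArg indicator (propext ⟨?_, ?_⟩)
  · rintro ⟨u, hu, h⟩
    refine ⟨u, u.2, ⟨u.2, i.2, hu⟩, ?_⟩
    rw [adj_eq_one_iff i.2 u.2 v.2]
    exact h.imp (fun h => congrArg Fin.val h.symm) id
  · rintro ⟨u, hu, ⟨_, _, h⟩, h'⟩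
    rw [adj_eq_one_iff i.2 hu v.2] at h'
    exact ⟨⟨u, hu⟩, h, h'.imp (fun h => Fin.ext h.symm) id⟩

/-! ### Timelines and values of states -/

/-- Families of intervals, at most `k` for each vertex, form a timeline. -/
theorem exists_timeline (Q : ℕ → Finset (ℕ × ℕ)) (hk : ∀ v < I.n, (Q v).card ≤ I.k)
    (hQ : ∀ v < I.n, ∀ x ∈ Q v, x.1 ≤ x.2 ∧ x.2 - x.1 ≤ I.ℓ ∧ x.2 < I.T) (A : ℕ → ℕ → Prop)
    (hA : ∀ i < I.T, ∀ v < I.n, A i v → ∃ x ∈ Q v, x.1 ≤ i ∧ i ≤ x.2) :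
    ∃ 𝒯 : Set (Fin I.n × Fin I.T × Fin I.T), IsTimeline I.k I.ℓ 𝒯 ∧
      ∑ i ∈ Finset.range I.T, I.numDominated i (A i) ≤ (dominatedSet I.graph 𝒯).ncard := by
  refine ⟨{x | ((x.2.1 : ℕ), (x.2.2 : ℕ)) ∈ Q x.1}, ⟨fun v a b h => ?_, fun v => ?_⟩, ?_⟩
  · have := hQ v v.2 _ h
    exact ⟨this.1, this.2.1⟩
  · refine le_trans ?_ (hk v v.2)
    rw [← Set.ncard_coe_finset]
    refine Set.ncard_le_ncard_of_injOn (fun x => ((x.1 : ℕ), (x.2 : ℕ))) (fun x hx => hx) ?_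
      (Finset.finite_toSet _)
    rintro ⟨a, b⟩ - ⟨a', b'⟩ - h
    simpa [Fin.ext_iff] using h
  · rw [ncard_dominatedSet]
    refine Finset.sum_le_sum fun i hi => numDominated_mono fun u hu h => ?_
    have hi := Finset.mem_range.1 hi
    obtain ⟨⟨a, b⟩, hx, h1, h2⟩ := hA i hi u hu h
    have := hQ u hu _ hx
    exact ⟨hu, hi, ⟨a, by simp at this h1 h2; omega⟩, ⟨b, this.2.2⟩, hx, h1, h2⟩

/-- An interval is opened whenever a digit drops from a multiple of `ℓ + 1`. The first `digit % (ℓ +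
1)` steps belong to an interval opened earlier, so coverage is claimed only after them, and only the
quotient is available for new intervals. -/
theorem exists_intervals_of_value (r : ℕ) (hr : r ≤ I.T) (p : ℕ) :
    ∃ (Q : ℕ → Finset (ℕ × ℕ)) (A : ℕ → ℕ → Prop),
      (∀ v < I.n, (Q v).card ≤ I.digit p v / (I.ℓ + 1)) ∧
      (∀ v < I.n, ∀ x ∈ Q v, x.1 ≤ x.2 ∧ x.2 - x.1 ≤ I.ℓ ∧ x.2 < I.T) ∧
      (∀ i < I.T, ∀ v < I.n, A i v → I.T - r + I.digit p v % (I.ℓ + 1) ≤ i →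
        ∃ x ∈ Q v, x.1 ≤ i ∧ i ≤ x.2) ∧
      I.value r p ≤ ∑ i ∈ Finset.Ico (I.T - r) I.T, I.numDominated i (A i) := by
  classical
  induction r generalizing p with
  | zero => exact ⟨fun _ => ∅, fun _ _ => False, by simp, by simp, by simp, by simp [value]⟩
  | succ r ih =>
    -- The supremum may be attained at a state that cannot follow; the value is then `0` and no
    -- interval is needed.
    have trivial_case : I.value (r + 1) p = 0 → ∃ (Q : ℕ → Finset (ℕ × ℕ)) (A : ℕ → ℕ → Prop),
        (∀ v < I.n, (Q v).card ≤ I.digit p v / (I.ℓ + 1)) ∧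
        (∀ v < I.n, ∀ x ∈ Q v, x.1 ≤ x.2 ∧ x.2 - x.1 ≤ I.ℓ ∧ x.2 < I.T) ∧
        (∀ i < I.T, ∀ v < I.n, A i v → I.T - (r + 1) + I.digit p v % (I.ℓ + 1) ≤ i →
          ∃ x ∈ Q v, x.1 ≤ i ∧ i ≤ x.2) ∧
        I.value (r + 1) p ≤ ∑ i ∈ Finset.Ico (I.T - (r + 1)) I.T, I.numDominated i (A i) :=
      fun h => ⟨fun _ => ∅, fun _ _ => False, by simp, by simp, by simp, by simp [h]⟩
    obtain ⟨q, hq, hv⟩ := Finset.exists_mem_eq_sup (Finset.range I.numStates)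
      ⟨0, Finset.mem_range.2 (Nat.pow_pos (Nat.succ_pos _))⟩ (fun q =>
        indicator (I.IsTransition p q) * (I.numDominated (I.T - (r + 1))
          (fun u => I.digit q u ≠ I.digit p u) + I.value r q))
    by_cases ht : I.IsTransition p q
    swap
    · refine trivial_case ?_
      rw [value, hv, indicator_false ht, zero_mul]
    rw [indicator_true ht, one_mul] at hv
    obtain ⟨Q, A, hk, hQ, hA, hs⟩ := ih (by omega) q
    have hm : I.T - (r + 1) + 1 = I.T - r := by omega
    have hT : I.T - (r + 1) < I.T := by omega
    rw [← hm] at hs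
    refine ⟨fun v => if I.digit q v + 1 = I.digit p v ∧ I.digit p v % (I.ℓ + 1) = 0 then
        insert (I.T - (r + 1), min (I.T - (r + 1) + I.ℓ) (I.T - 1)) (Q v) else Q v,
      fun i u => if i = I.T - (r + 1) then I.digit q u ≠ I.digit p u else A i u, ?_, ?_, ?_, ?_⟩
    · intro v hv
      have h1 := hk v hv
      dsimp only
      split_ifs with hc
      · refine (Finset.card_insert_le _ _).trans ?_
        have := succ_div_mod_cases (I.digit q v) (s := I.ℓ + 1) (by omega)
        rw [hc.1] at this
        omega
      · rcases ht v hv with h | ⟨h, -⟩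
        · have := succ_div_mod_cases (I.digit q v) (s := I.ℓ + 1) (by omega)
          rw [h] at this
          omega
        · rwa [← h]
    · intro v hv x hx
      dsimp only at hx
      split_ifs at hx
      · rcases Finset.mem_insert.1 hx with rfl | hx
        · dsimp only
          omega
        · exact hQ v hv x hx
      · exact hQ v hv x hx
    · intro i hi v hv h hri
      have hqp := succ_div_mod_cases (I.digit q v) (s := I.ℓ + 1) (by omega)
      have hlt : I.digit q v % (I.ℓ + 1) < I.ℓ + 1 := Nat.mod_lt _ (by omega)
      dsimp only at h ⊢
      split_ifs at h with hi'
      · have h1 := (ht v hv).resolve_right fun h' => h h'.1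
        have h2 : I.digit p v % (I.ℓ + 1) = 0 := by omega
        rw [if_pos ⟨h1, h2⟩]
        exact ⟨_, Finset.mem_insert_self _ _, by dsimp only; omega, by dsimp only; omega⟩
      -- Beyond the block running in `q`, the induction hypothesis provides the interval. Otherwise
      -- `i` is in that block, but beyond the one running in `p`; so the block has just been opened,
      -- and the inserted interval covers `i`.
      · by_cases hle : I.T - r + I.digit q v % (I.ℓ + 1) ≤ i
        · obtain ⟨x, hx, h1⟩ := hA i hi v hv h hle
          refine ⟨x, ?_, h1⟩
          split_ifs
          · exact Finset.mem_insert_of_mem hx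
          · exact hx
        · rcases ht v hv with h1 | ⟨h1, h2⟩
          · rw [h1] at hqp
            have h2 : I.digit p v % (I.ℓ + 1) = 0 := by omega
            rw [if_pos ⟨h1, h2⟩]
            exact ⟨_, Finset.mem_insert_self _ _, by dsimp only; omega, by dsimp only; omega⟩
          · rw [h1] at hle
            omega
    · rw [value, hv, Finset.sum_eq_sum_Ico_succ_bot hT]
      refine Nat.add_le_add (le_of_eq (by simp)) (hs.trans (Finset.sum_le_sum fun i hi => ?_))
      have : i ≠ I.T - (r + 1) := by
        have := (Finset.mem_Ico.1 hi).1
        omega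
      exact numDominated_mono fun u _ h => by simpa [this] using h

/-- The initial state is arbitrary. A nonzero remainder stands for a block already running at time
`0`, which costs one more interval. The bound `k` survives, because a digit at most `k * (ℓ + 1)`
with nonzero remainder has quotient less than `k`. -/
theorem exists_timeline_of_value (p : ℕ) :
    ∃ 𝒯 : Set (Fin I.n × Fin I.T × Fin I.T), IsTimeline I.k I.ℓ 𝒯 ∧
      I.value I.T p ≤ (dominatedSet I.graph 𝒯).ncard := by
  classical
  obtain ⟨Q, A, hk, hQ, hA, hs⟩ := exists_intervals_of_value I.T le_rfl p
  have hT := I.one_le_T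
  let Q' : ℕ → Finset (ℕ × ℕ) := fun v => if I.digit p v % (I.ℓ + 1) = 0 then Q v
      else insert (0, min (I.digit p v % (I.ℓ + 1) - 1) (I.T - 1)) (Q v)
  have hk' : ∀ v < I.n, (Q' v).card ≤ I.k := by
    intro v hv
    have h1 := hk v hv
    have h2 : I.digit p v ≤ I.k * (I.ℓ + 1) := digit_le p v
    have h3 := Nat.div_add_mod (I.digit p v) (I.ℓ + 1)
    have h4 : I.digit p v / (I.ℓ + 1) ≤ I.k := Nat.div_le_of_le_mul (by rwa [mul_comm])
    dsimp only [Q']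
    split_ifs with hc
    · exact h1.trans h4
    · refine (Finset.card_insert_le _ _).trans ?_
      have : I.digit p v / (I.ℓ + 1) ≠ I.k := by
        intro h5
        rw [h5, mul_comm] at h3
        omega
      omega
  have hQ' : ∀ v < I.n, ∀ x ∈ Q' v, x.1 ≤ x.2 ∧ x.2 - x.1 ≤ I.ℓ ∧ x.2 < I.T := by
    intro v hv x hx
    dsimp only [Q'] at hx
    split_ifs at hx
    · exact hQ v hv x hx
    · rcases Finset.mem_insert.1 hx with rfl | hx
      · have := Nat.mod_lt (I.digit p v) (Nat.succ_pos I.ℓ)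
        simp only [Nat.succ_eq_add_one] at this
        dsimp only
        omega
      · exact hQ v hv x hx
  obtain ⟨𝒯, h𝒯, h⟩ := exists_timeline Q' hk' hQ' A (by
    intro i hi v hv h
    dsimp only [Q']
    by_cases hle : I.T - I.T + I.digit p v % (I.ℓ + 1) ≤ i
    · obtain ⟨x, hx, h1⟩ := hA i hi v hv h hle
      refine ⟨x, ?_, h1⟩
      split_ifs
      · exact hx
      · exact Finset.mem_insert_of_mem hx
    · rw [if_neg (by omega)]
      exact ⟨_, Finset.mem_insert_self _ _, by dsimp only; omega, by dsimp only; omega⟩)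
  refine ⟨𝒯, h𝒯, le_trans ?_ h⟩
  rwa [Nat.sub_self, ← Finset.range_eq_Ico] at hs

/-- The countdowns of all vertices, run in parallel, are the digits of a legal sequence of states.
Every active vertex changes its digit, and further changes can only add dominated vertices. -/
theorem exists_le_value {𝒯 : Set (Fin I.n × Fin I.T × Fin I.T)} (h𝒯 : IsTimeline I.k I.ℓ 𝒯) :
    ∃ p < I.numStates, (dominatedSet I.graph 𝒯).ncard ≤ I.value I.T p := by
  classical
  let F : Fin I.n → Finset (ℕ × ℕ) := fun v =>
    {x : Fin I.T × Fin I.T | (v, x.1, x.2) ∈ 𝒯}.toFinset.image fun x => ((x.1 : ℕ), (x.2 : ℕ))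
  have hF : ∀ v, (F v).card ≤ I.k := fun v => Finset.card_image_le.trans <| by
    rw [← Set.ncard_eq_toFinset_card']
    exact h𝒯.2 v
  have hℓ : ∀ v, ∀ x ∈ F v, x.2 - x.1 ≤ I.ℓ := by
    intro v x hx
    obtain ⟨y, hy, rfl⟩ := Finset.mem_image.1 hx
    exact (h𝒯.1 v y.1 y.2 (by simpa using hy)).2
  choose s hs hs' using fun v => exists_countdown (F v) (hF v) (hℓ v)
  have hst : ∀ i, ∃ p < I.numStates, ∀ v (hv : v < I.n), I.digit p v = s ⟨v, hv⟩ i := by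
    intro i
    obtain ⟨p, hp, h⟩ := exists_lt_pow_forall_digit_eq (B := I.budget + 1) (n := I.n)
      (fun v => if hv : v < I.n then s ⟨v, hv⟩ i else 0) (fun v hv => by
        rw [dif_pos hv]
        exact Nat.lt_succ_of_le (hs _ i))
    exact ⟨p, hp, fun v hv => (h v hv).trans (dif_pos hv)⟩
  choose p hp hd using hst
  refine ⟨p 0, hp 0, ?_⟩
  have key : ∀ r ≤ I.T, ∑ i ∈ Finset.Ico (I.T - r) I.T, I.numDominated i
      (fun u => ∃ (hu : u < I.n) (hi : i < I.T), ⟨u, hu⟩ ∈ activeSet 𝒯 ⟨i, hi⟩)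
      ≤ I.value r (p (I.T - r)) := by
    intro r
    induction r with
    | zero => simp
    | succ r ih =>
      intro hr
      have hm : I.T - (r + 1) + 1 = I.T - r := by omega
      have ih := ih (by omega)
      rw [← hm] at ih
      rw [Finset.sum_eq_sum_Ico_succ_bot (by omega), value]
      refine le_trans ?_ (Finset.le_sup (b := p (I.T - (r + 1) + 1)) (Finset.mem_range.2 (hp _)))
      have ht : I.IsTransition (p (I.T - (r + 1))) (p (I.T - (r + 1) + 1)) := by
        intro v hv
        rw [hd _ v hv, hd _ v hv]
        exact (hs' ⟨v, hv⟩ _).1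
      rw [indicator_true ht, one_mul]
      refine Nat.add_le_add (numDominated_mono fun u hu h => ?_) ih
      rw [hd _ u hu, hd _ u hu]
      obtain ⟨_, hi, a, b, hab, h1, h2⟩ := h
      exact (hs' ⟨u, hu⟩ _).2 ⟨((a : ℕ), (b : ℕ)),
        Finset.mem_image.2 ⟨(a, b), by simpa using hab, rfl⟩, h1, h2⟩
  have := key I.T le_rfl
  rwa [Nat.sub_self, ← Finset.range_eq_Ico, ← ncard_dominatedSet] at this

theorem isYes_iff_value : I.IsYes ↔ ∃ p < I.numStates, I.t ≤ I.value I.T p := by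
  constructor
  · rintro ⟨𝒯, h𝒯, ht⟩
    obtain ⟨p, hp, h⟩ := exists_le_value h𝒯
    exact ⟨p, hp, ht.trans h⟩
  · rintro ⟨p, -, hp⟩
    obtain ⟨𝒯, h𝒯, h⟩ := exists_timeline_of_value (I := I) p
    exact ⟨𝒯, h𝒯, hp.trans h⟩

/-! ### Instances decided by counting -/

theorem IsYes.le_mul (h : I.IsYes) : I.t ≤ I.n * I.T := by
  obtain ⟨𝒯, -, h⟩ := h
  exact h.trans ((Set.ncard_le_card _).trans (by simp))

/-- Intervals starting at consecutive multiples of `ℓ + 1`, cut off at the end of the lifetime, keep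
every vertex active at all times below `budget`. At each of these times all `n` vertices dominate
themselves. -/
theorem isYes_of_le_budget (h : I.t ≤ I.n * I.T) (h' : I.t ≤ I.n * I.budget) : I.IsYes := by
  classical
  have hT := I.one_le_T
  obtain ⟨𝒯, h𝒯, h1⟩ := exists_timeline (I := I)
    (fun _ => ((Finset.range I.k).image fun c => (c * (I.ℓ + 1),
      min (c * (I.ℓ + 1) + I.ℓ) (I.T - 1))).filter fun x => x.1 < I.T)
    (fun _ _ => (Finset.card_filter_le _ _).trans (Finset.card_image_le.trans (by simp)))
    (by
      intro v hv x hx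
      obtain ⟨hx, hxT⟩ := Finset.mem_filter.1 hx
      obtain ⟨c, -, rfl⟩ := Finset.mem_image.1 hx
      dsimp only at hxT ⊢
      omega) (fun i _ => i < I.budget)
    (by
      intro i hi v hv h
      have h1 := Nat.div_add_mod i (I.ℓ + 1)
      have h2 := Nat.mod_lt i (Nat.succ_pos I.ℓ)
      simp only [Nat.succ_eq_add_one] at h2
      rw [mul_comm] at h1
      refine ⟨_, Finset.mem_filter.2 ⟨Finset.mem_image.2 ⟨i / (I.ℓ + 1), Finset.mem_range.2
        (Nat.div_lt_of_lt_mul (by rwa [mul_comm])), rfl⟩, ?_⟩, ?_, ?_⟩ <;> dsimp only <;> omega)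
  refine ⟨𝒯, h𝒯, le_trans ?_ h1⟩
  have h2 : ∀ i ∈ Finset.range (min I.T I.budget),
      I.n ≤ I.numDominated i (fun _ => i < I.budget) := by
    intro i hi
    have hi := Finset.mem_range.1 hi
    unfold numDominated
    refine le_trans (by simp) (Finset.sum_le_sum (f := fun _ => 1) fun v hv => ?_)
    rw [indicator_true ⟨v, Finset.mem_range.1 hv, by omega, Or.inl rfl⟩]
  calc I.t ≤ min (I.n * I.T) (I.n * I.budget) := le_min h h'
    _ = ∑ i ∈ Finset.range (min I.T I.budget), I.n := by
      rw [Finset.sum_const, Finset.card_range, smul_eq_mul, mul_comm _ I.n,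
        Nat.mul_min_mul_left]
    _ ≤ _ := Finset.sum_le_sum h2
    _ ≤ _ := Finset.sum_le_sum_of_subset (Finset.range_mono (min_le_left _ _))

end PDSInstance

/-! ### The program -/

namespace PDSInstance

/-- The number `x`, followed by the first `K` entries of the adjacency matrices, in binary. -/
noncomputable def packed (I : PDSInstance) : ℕ → ℕ → ℕ
  | 0, x => x
  | K + 1, x => packed I K (2 * x + I.encode (K + 5))

/-- Neither are there too few temporal vertices, nor can `t` of them be active. -/
def IsHard (I : PDSInstance) : Prop := I.t ≤ I.n * I.T ∧ I.n * I.budget < I.t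

variable {I : PDSInstance}

theorem encode_add_five_le_one (m : ℕ) : I.encode (m + 5) ≤ 1 := by
  rw [encode_add_five]
  exact indicator_le_one _

theorem packed_div_pow (K x : ℕ) : I.packed K x / 2 ^ K = x := by
  induction K generalizing x with
  | zero => simp [packed]
  | succ K ih =>
    have := encode_add_five_le_one (I := I) K
    rw [packed, pow_succ, ← Nat.div_div_eq_div_mul, ih]
    omega

/-- Entries are shifted in from number `K - 1` down to number `0`, so entry `j` ends up as bit `j`.
-/
theorem packed_div_pow_mod_two {K j : ℕ} (hj : j < K) (x : ℕ) :
    I.packed K x / 2 ^ j % 2 = I.encode (j + 5) := by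
  induction K generalizing x with
  | zero => omega
  | succ K ih =>
    rw [packed]
    rcases Nat.lt_succ_iff_lt_or_eq.1 hj with h | rfl
    · exact ih h _
    · have := encode_add_five_le_one (I := I) j
      rw [packed_div_pow]
      omega

theorem packed_lt (K x : ℕ) : I.packed K x < 2 ^ K * (x + 1) := by
  have := packed_div_pow (I := I) K x
  rw [mul_comm]
  exact (Nat.div_lt_iff_lt_mul (Nat.two_pow_pos K)).1 (by omega)

theorem IsHard.n_pos (h : I.IsHard) : 0 < I.n := by
  rcases Nat.eq_zero_or_pos I.n with h0 | h0
  · have := h.1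
    have := h.2
    simp [h0] at *
    omega
  · exact h0

theorem IsHard.budget_lt (h : I.IsHard) : I.budget < I.t :=
  (Nat.le_mul_of_pos_left _ h.n_pos).trans_lt h.2

theorem IsHard.k_lt (h : I.IsHard) : I.k < I.t :=
  (Nat.le_mul_of_pos_right _ (Nat.succ_pos I.ℓ)).trans_lt h.budget_lt

theorem IsHard.numStates_le (h : I.IsHard) : I.numStates ≤ 2 ^ I.t :=
  calc (I.budget + 1) ^ I.n ≤ (2 ^ I.budget) ^ I.n := Nat.pow_le_pow_left Nat.lt_two_pow_self _
    _ = 2 ^ (I.n * I.budget) := by rw [← pow_mul, mul_comm]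
    _ ≤ 2 ^ I.t := Nat.pow_le_pow_right (by omega) h.2.le

theorem numStates_pos : 0 < I.numStates := Nat.pow_pos (Nat.succ_pos _)

/-- The factor `k - (k - t)` is `min k t`. The input number `k` may be too large to be a number of
rounds in a multiplication; capping it at `t` is harmless, since for `k ≥ t` and `n > 0` both
products are at least `t`. -/
theorem isHard_iff : I.IsHard ↔
    I.t ≤ I.n * I.T ∧ I.n * ((I.k - (I.k - I.t)) * (I.ℓ + 1)) < I.t := by
  unfold IsHard budget
  refine and_congr_right fun h => ?_
  rcases le_total I.k I.t with hk | hk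
  · rw [Nat.sub_eq_zero_of_le hk, Nat.sub_zero]
  · rw [Nat.sub_sub_self hk]
    rcases Nat.eq_zero_or_pos I.n with h0 | h0
    · simp [h0]
    · have h1 : I.t ≤ I.n * (I.t * (I.ℓ + 1)) :=
        (Nat.le_mul_of_pos_right _ (Nat.succ_pos _)).trans (Nat.le_mul_of_pos_left _ h0)
      have h2 : I.n * (I.t * (I.ℓ + 1)) ≤ I.n * (I.k * (I.ℓ + 1)) := by gcongr
      omega

theorem isYes_iff_of_not_isHard (h : ¬I.IsHard) : I.IsYes ↔ I.t ≤ I.n * I.T :=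
  ⟨IsYes.le_mul, fun h' => isYes_of_le_budget h' (by
    by_contra h''
    exact h ⟨h', by omega⟩)⟩

end PDSInstance

/-! ### Access to the instance -/

namespace View

variable {γ : Type} {V : View γ} {I : γ → PDSInstance}

/-- The view gives access to the instance `I s`. -/
structure Over (V : View γ) (I : γ → PDSInstance) : Prop where
  five_le : 5 ≤ V.m
  -- Here `V.rad s - 5` is the number of packed entries. The heap is prescribed only where the input
  -- lies, so that a table may be written behind it.
  reg_zero : ∀ s, V.reg s 0 = (I s).packed (V.rad s - 5) (I s).n
  reg_one : ∀ s, V.reg s 1 = (I s).T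
  reg_two : ∀ s, V.reg s 2 = (I s).k
  reg_three : ∀ s, V.reg s 3 = (I s).ℓ
  reg_four : ∀ s, V.reg s 4 = (I s).t
  heap : ∀ s j, j + (V.rad s - 5) < (I s).T * ((I s).n * (I s).n) →
    V.heap s j = (I s).encode (j + (V.rad s - 5) + 5)
  -- For a fixed radius, powers of this size have the required form. The first factor makes the
  -- packed number polynomially bounded; the summand `1` makes the size at least `2`.
  size : ∀ s, V.size s = 2 ^ (V.rad s - 5) * (2 ^ (I s).t * ((I s).n + (I s).T)) + 1

theorem Over.loop (hV : V.Over I) (N : γ → ℕ) (A : γ → ℕ → ℕ) :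
    (V.loop N A).Over (fun s => I s.1) := by
  have h5 := hV.five_le
  have h : ∀ s, ∀ i < 5, (V.loop N A).reg s i = V.reg s.1 i := fun s i hi => by
    simp [View.loop, show i ≠ V.m by omega, show i ≠ V.m + 1 by omega]
  exact ⟨h5.trans (Nat.le_add_right _ _), fun s => (h s 0 (by omega)).trans (hV.reg_zero s.1),
    fun s => (h s 1 (by omega)).trans (hV.reg_one s.1),
    fun s => (h s 2 (by omega)).trans (hV.reg_two s.1),
    fun s => (h s 3 (by omega)).trans (hV.reg_three s.1),
    fun s => (h s 4 (by omega)).trans (hV.reg_four s.1),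
    fun s => hV.heap s.1, fun s => hV.size s.1⟩

theorem Over.restrict (hV : V.Over I) (p : γ → Prop) : (V.restrict p).Over (fun s => I s.1) :=
  ⟨hV.five_le, fun s => hV.reg_zero s.1, fun s => hV.reg_one s.1, fun s => hV.reg_two s.1,
    fun s => hV.reg_three s.1, fun s => hV.reg_four s.1, fun s => hV.heap s.1,
    fun s => hV.size s.1⟩

theorem Over.withTable (hV : V.Over I) {base : γ → ℕ} (tab : γ → ℕ → ℕ) (N : γ → ℕ)
    (hb : ∀ s, (I s).T * ((I s).n * (I s).n) ≤ base s) : (V.withTable base tab N).Over I :=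
  ⟨hV.five_le, hV.reg_zero, hV.reg_one, hV.reg_two, hV.reg_three, hV.reg_four, fun s j hj => by
    have hj : j + (V.rad s - 5) < (I s).T * ((I s).n * (I s).n) := hj
    have := hb s
    exact (if_neg (by omega)).trans (hV.heap s j hj), hV.size⟩

namespace Over

theorem polyBounded (hV : V.Over I) {f : γ → ℕ}
    (h : ∀ s, f s ≤ 2 ^ (V.rad s - 5) * (2 ^ (I s).t * ((I s).n + (I s).T))) : V.PolyBounded f :=
  V.polyBounded_size.of_le fun s => by
    rw [hV.size]
    exact (h s).trans (Nat.le_succ _)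

theorem polyBounded_n_add_T (hV : V.Over I) : V.PolyBounded (fun s => (I s).n + (I s).T) :=
  hV.polyBounded fun _ => (Nat.le_mul_of_pos_left _ (Nat.two_pow_pos _)).trans
    (Nat.le_mul_of_pos_left _ (Nat.two_pow_pos _))

theorem polyBounded_n (hV : V.Over I) : V.PolyBounded (fun s => (I s).n) :=
  hV.polyBounded_n_add_T.of_le fun _ => Nat.le_add_right _ _

theorem polyBounded_T (hV : V.Over I) : V.PolyBounded (fun s => (I s).T) :=
  hV.polyBounded_n_add_T.of_le fun _ => Nat.le_add_left _ _

theorem polyBounded_two_pow_t (hV : V.Over I) : V.PolyBounded (fun s => 2 ^ (I s).t) :=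
  hV.polyBounded fun s => (Nat.le_mul_of_pos_right _ ((I s).one_le_T.trans
    (Nat.le_add_left _ _))).trans (Nat.le_mul_of_pos_left _ (Nat.two_pow_pos _))

theorem polyBounded_t (hV : V.Over I) : V.PolyBounded (fun s => (I s).t) :=
  hV.polyBounded_two_pow_t.of_le fun _ => Nat.lt_two_pow_self.le

theorem polyBounded_two_pow_rad (hV : V.Over I) : V.PolyBounded (fun s => 2 ^ (V.rad s - 5)) :=
  hV.polyBounded fun s => Nat.le_mul_of_pos_right _ (Nat.mul_pos (Nat.two_pow_pos _)
    ((I s).one_le_T.trans (Nat.le_add_left _ _)))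

theorem polyBounded_rad (hV : V.Over I) : V.PolyBounded (fun s => V.rad s - 5) :=
  hV.polyBounded_two_pow_rad.of_le fun _ => Nat.lt_two_pow_self.le

theorem polyBounded_packed (hV : V.Over I) :
    V.PolyBounded (fun s => (I s).packed (V.rad s - 5) (I s).n) :=
  hV.polyBounded fun s => (PDSInstance.packed_lt _ _).le.trans (Nat.mul_le_mul_left _
    ((Nat.add_le_add_left (I s).one_le_T _).trans (Nat.le_mul_of_pos_left _ (Nat.two_pow_pos _))))

theorem computes_packed (hV : V.Over I) :
    V.Computes (fun s => (I s).packed (V.rad s - 5) (I s).n) :=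
  (V.computes_reg (by have := hV.five_le; omega)).congr hV.reg_zero

theorem computes_T (hV : V.Over I) : V.Computes (fun s => (I s).T) :=
  (V.computes_reg (by have := hV.five_le; omega)).congr hV.reg_one

theorem computes_k (hV : V.Over I) : V.Computes (fun s => (I s).k) :=
  (V.computes_reg (by have := hV.five_le; omega)).congr hV.reg_two

theorem computes_ℓ (hV : V.Over I) : V.Computes (fun s => (I s).ℓ) :=
  (V.computes_reg (by have := hV.five_le; omega)).congr hV.reg_three

theorem computes_t (hV : V.Over I) : V.Computes (fun s => (I s).t) :=
  (V.computes_reg (by have := hV.five_le; omega)).congr hV.reg_four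

theorem computes_n (hV : V.Over I) : V.Computes (fun s => (I s).n) :=
  (hV.computes_packed.div ((V.computes_const 2).pow (V.computes_rad_sub 5) (V.polyBounded_const 2)
    hV.polyBounded_rad) hV.polyBounded_packed fun _ => Nat.two_pow_pos _).congr
    fun _ => PDSInstance.packed_div_pow _ _

/-- An entry is either a bit of the packed number or still in its place on the heap. Only in the
first branch is `f s` an exponent, and there it is less than the number of packed entries. -/
theorem computes_encode (hV : V.Over I) {f : γ → ℕ} (hf : V.Computes f)
    (h : ∀ s, f s < (I s).T * ((I s).n * (I s).n)) :
    V.Computes (fun s => (I s).encode (f s + 5)) := by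
  classical
  refine (Computes.ite (p := fun s => f s < V.rad s - 5)
    (f := fun s => (I s).packed (V.rad s - 5) (I s).n / 2 ^ f s % 2)
    (g := fun s => V.heap s (f s - (V.rad s - 5))) (hf.lt (V.computes_rad_sub 5)) ?_ ?_).congr
    fun s => ?_
  · have h2 := (V.restrict fun s => f s < V.rad s - 5).computes_const 2
    have p := hV.polyBounded_packed.restrict fun s => f s < V.rad s - 5
    refine Computes.mod (Computes.div (hV.computes_packed.restrict _) (h2.pow (hf.restrict _)
      (polyBounded_const _ 2) ((hV.polyBounded_rad.restrict _).of_le fun s => s.2.le)) p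
      fun _ => Nat.two_pow_pos _) h2 (p.of_le fun s => Nat.div_le_self _ _) fun _ => two_pos
  · exact (hf.sub (V.computes_rad_sub 5)).heap.restrict _
  · have := h s
    split_ifs with hs
    · exact PDSInstance.packed_div_pow_mod_two hs _
    · rw [hV.heap _ _ (by omega), Nat.sub_add_cancel (by omega)]

theorem computes_adj (hV : V.Over I) {i u v : γ → ℕ} (hi : V.Computes i) (hu : V.Computes u)
    (hv : V.Computes v) (hiT : ∀ s, i s < (I s).T) (hun : ∀ s, u s < (I s).n)
    (hvn : ∀ s, v s < (I s).n) : V.Computes (fun s => (I s).adj (i s) (u s) (v s)) := by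
  refine hV.computes_encode (((hi.mul (hV.computes_n.mul hV.computes_n hV.polyBounded_n)
    (hV.polyBounded_T.of_le fun s => (hiT s).le)).add (hu.mul hV.computes_n
      (hV.polyBounded_n.of_le fun s => (hun s).le))).add hv) fun s => ?_
  have h1 := hiT s
  have h2 := hun s
  have h3 := hvn s
  calc i s * ((I s).n * (I s).n) + u s * (I s).n + v s
      < i s * ((I s).n * (I s).n) + (u s + 1) * (I s).n := by
        rw [Nat.succ_mul]
        omega
    _ ≤ i s * ((I s).n * (I s).n) + (I s).n * (I s).n := by gcongr; omega
    _ = (i s + 1) * ((I s).n * (I s).n) := (Nat.succ_mul _ _).symm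
    _ ≤ _ := by gcongr; omega

/-! ### The ingredients of the recursion on the machine -/

theorem decides_isHard (hV : V.Over I) : V.Decides (fun s => (I s).IsHard) := by
  have hk := hV.computes_k.sub (hV.computes_k.sub hV.computes_t)
  refine ((hV.computes_t.le (hV.computes_n.mul hV.computes_T hV.polyBounded_n)).and
    (Computes.lt (hV.computes_n.mul (hk.mul (hV.computes_ℓ.add (V.computes_const 1))
    (hV.polyBounded_t.of_le fun s => by omega)) hV.polyBounded_n) hV.computes_t)).congr
    fun s => PDSInstance.isHard_iff.symm

theorem computes_budget (hV : V.Over I) (hH : ∀ s, (I s).IsHard) :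
    V.Computes (fun s => (I s).budget) :=
  hV.computes_k.mul (hV.computes_ℓ.add (V.computes_const 1))
    (hV.polyBounded_t.of_le fun s => (hH s).k_lt.le)

theorem computes_base (hV : V.Over I) (hH : ∀ s, (I s).IsHard) :
    V.Computes (fun s => (I s).budget + 1) :=
  (hV.computes_budget hH).add (V.computes_const 1)

theorem polyBounded_base (hV : V.Over I) (hH : ∀ s, (I s).IsHard) :
    V.PolyBounded (fun s => (I s).budget + 1) :=
  hV.polyBounded_t.of_le fun s => (hH s).budget_lt

theorem computes_numStates (hV : V.Over I) (hH : ∀ s, (I s).IsHard) :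
    V.Computes (fun s => (I s).numStates) :=
  (hV.computes_base hH).pow hV.computes_n (hV.polyBounded_base hH) hV.polyBounded_n

theorem polyBounded_numStates (hV : V.Over I) (hH : ∀ s, (I s).IsHard) :
    V.PolyBounded (fun s => (I s).numStates) :=
  hV.polyBounded_two_pow_t.of_le fun s => (hH s).numStates_le

theorem computes_digit (hV : V.Over I) (hH : ∀ s, (I s).IsHard) {p v : γ → ℕ}
    (hp : V.Computes p) (pp : V.PolyBounded p) (hv : V.Computes v)
    (hvn : ∀ s, v s < (I s).n) : V.Computes (fun s => (I s).digit (p s) (v s)) :=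
  (hp.div ((hV.computes_base hH).pow hv (hV.polyBounded_base hH)
    (hV.polyBounded_n.of_le fun s => (hvn s).le)) pp fun _ => Nat.pow_pos (Nat.succ_pos _)).mod
    (hV.computes_base hH) (pp.of_le fun _ => Nat.div_le_self _ _) fun _ => Nat.succ_pos _

theorem decides_isTransition (hV : V.Over I) (hH : ∀ s, (I s).IsHard) {p q : γ → ℕ}
    (hp : V.Computes p) (pp : V.PolyBounded p) (hq : V.Computes q) (pq : V.PolyBounded q) :
    V.Decides (fun s => (I s).IsTransition (p s) (q s)) := by
  refine Decides.ball (p := fun s v => (I s).digit (q s) v + 1 = (I s).digit (p s) v ∨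
    (I s).digit (q s) v = (I s).digit (p s) v ∧ (I s).digit (p s) v % ((I s).ℓ + 1) = 0)
    hV.computes_n hV.polyBounded_n fun A => ?_
  have hV' := hV.loop (fun s => (I s).n) A
  have hi := V.computes_loop_index (fun s => (I s).n) A
  have dp := hV'.computes_digit (fun s => hH s.1) (hp.loop _ A) (pp.loop _ A) hi fun s => s.2.2
  have dq := hV'.computes_digit (fun s => hH s.1) (hq.loop _ A) (pq.loop _ A) hi fun s => s.2.2
  have hc := fun c => (V.loop (fun s => (I s).n) A).computes_const c
  exact ((dq.add (hc 1)).eq dp).or ((dq.eq dp).and (Computes.eq (dp.mod (hV'.computes_ℓ.add (hc 1))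
    ((hV'.polyBounded_base fun s => hH s.1).of_le fun s =>
      (PDSInstance.digit_le _ _).trans (Nat.le_succ _)) fun _ => Nat.succ_pos _) (hc 0)))

theorem computes_numDominated (hV : V.Over I) (hH : ∀ s, (I s).IsHard) {i p q : γ → ℕ}
    (hi : V.Computes i) (hiT : ∀ s, i s < (I s).T) (hp : V.Computes p) (pp : V.PolyBounded p)
    (hq : V.Computes q) (pq : V.PolyBounded q) :
    V.Computes (fun s => (I s).numDominated (i s)
      (fun u => (I s).digit (q s) u ≠ (I s).digit (p s) u)) := by
  refine Computes.sum (g := fun s v => indicator (∃ u < (I s).n, (I s).digit (q s) u ≠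
    (I s).digit (p s) u ∧ (u = v ∨ (I s).adj (i s) u v = 1))) hV.computes_n hV.polyBounded_n
    fun A => ?_
  have hV' := hV.loop (fun s => (I s).n) A
  have hv := V.computes_loop_index (fun s => (I s).n) A
  refine Decides.bex (p := fun (s : (s : γ) × Fin (I s).n) u => (I s.1).digit (q s.1) u ≠
    (I s.1).digit (p s.1) u ∧ (u = s.2 ∨ (I s.1).adj (i s.1) u s.2 = 1)) hV'.computes_n
    hV'.polyBounded_n fun A' => ?_
  have hV'' := hV'.loop (fun s => (I s.1).n) A'
  have hu := (V.loop (fun s => (I s).n) A).computes_loop_index (fun s => (I s.1).n) A'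
  have dp := hV''.computes_digit (fun s => hH s.1.1) ((hp.loop _ A).loop _ A')
    ((pp.loop _ A).loop _ A') hu fun s => s.2.2
  have dq := hV''.computes_digit (fun s => hH s.1.1) ((hq.loop _ A).loop _ A')
    ((pq.loop _ A).loop _ A') hu fun s => s.2.2
  exact (dq.eq dp).not.and ((hu.eq (hv.loop _ A')).or (Computes.eq (hV''.computes_adj
    ((hi.loop _ A).loop _ A') hu (hv.loop _ A') (fun s => hiT s.1.1) (fun s => s.2.2)
    fun s => s.1.2.2) (computes_const _ 1)))

end Over

end View

/-! ### The table of values -/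

namespace PDSInstance

/-- The position in the heap at which the table of the values starts. -/
def tableStart (I : PDSInstance) : ℕ := I.T * (I.n * I.n)

/-- The entries of the table: the values of all the states, for `0, 1, …` time steps. -/
noncomputable def tableEntry (I : PDSInstance) (j : ℕ) : ℕ :=
  I.value (j / I.numStates) (j % I.numStates)

open Classical in
/-- The number of entries of the table. -/
noncomputable def tableSize (I : PDSInstance) : ℕ :=
  if I.IsHard then (I.T + 1) * I.numStates else 0

variable {I : PDSInstance}

theorem tableEntry_mul_add (r : ℕ) {q : ℕ} (hq : q < I.numStates) :
    I.tableEntry (r * I.numStates + q) = I.value r q := by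
  unfold tableEntry
  rw [mul_comm, Nat.mul_add_div numStates_pos, Nat.div_eq_of_lt hq, Nat.mul_add_mod,
    Nat.mod_eq_of_lt hq, Nat.add_zero]

theorem isHard_of_lt_tableSize {j : ℕ} (h : j < I.tableSize) : I.IsHard := by
  by_contra hI
  simp [tableSize, hI] at h

theorem tableSize_eq (h : I.IsHard) : I.tableSize = (I.T + 1) * I.numStates := if_pos h

end PDSInstance

namespace View

variable {γ : Type} {V : View γ} {I : γ → PDSInstance}

namespace Over

theorem computes_tableStart (hV : V.Over I) : V.Computes (fun s => (I s).tableStart) :=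
  hV.computes_T.mul (hV.computes_n.mul hV.computes_n hV.polyBounded_n) hV.polyBounded_T

theorem computes_tableSize (hV : V.Over I) : V.Computes (fun s => (I s).tableSize) := by
  classical
  refine (Computes.ite (p := fun s => (I s).IsHard) (f := fun s => ((I s).T + 1) * (I s).numStates)
    (g := fun _ => 0) hV.decides_isHard ?_ (computes_const _ 0)).congr fun s => ?_
  · have hV' := hV.restrict fun s => (I s).IsHard
    exact (hV'.computes_T.add (computes_const _ 1)).mul (hV'.computes_numStates fun s => s.2)
      (hV'.polyBounded_T.add (polyBounded_const _ 1))
  · unfold PDSInstance.tableSize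
    split_ifs <;> rfl

/-- This relies on the table being empty for instances that are not hard, where `numStates` need not
be bounded by `2 ^ t`. -/
theorem polyBounded_tableSize (hV : V.Over I) : V.PolyBounded (fun s => (I s).tableSize) := by
  refine ((hV.polyBounded_T.add (V.polyBounded_const 1)).mul hV.polyBounded_two_pow_t).of_le
    fun s => ?_
  unfold PDSInstance.tableSize
  split_ifs with h
  · exact Nat.mul_le_mul_left _ h.numStates_le
  · exact Nat.zero_le _

/-- The recursion for the entries of the table. -/
theorem computes_tableEntry (hV : V.Over I) (hH : ∀ s, (I s).IsHard) {j : γ → ℕ}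
    (hj : V.Computes j) (hjs : ∀ s, j s < (I s).tableSize)
    (hh : ∀ s, ∀ x < j s, V.heap s ((I s).tableStart + x) = (I s).tableEntry x) :
    V.Computes (fun s => (I s).tableEntry (j s)) := by
  classical
  have pj : V.PolyBounded j := hV.polyBounded_tableSize.of_le fun s => (hjs s).le
  -- The table has one row of `numStates` entries for each number of remaining time steps. Row `0`
  -- is zero; the values needed for any other entry are in the preceding row, which is already
  -- complete.
  refine (Computes.ite (p := fun s => j s < (I s).numStates) (f := fun _ => 0)
    (g := fun s => (Finset.range (I s).numStates).sup fun q =>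
      indicator ((I s).IsTransition (j s % (I s).numStates) q) *
        ((I s).numDominated ((I s).T - j s / (I s).numStates)
          (fun u => (I s).digit q u ≠ (I s).digit (j s % (I s).numStates) u) +
        V.heap s ((I s).tableStart + ((j s / (I s).numStates - 1) * (I s).numStates + q))))
    (hj.lt (hV.computes_numStates hH)) (computes_const _ 0) ?_).congr fun s => ?_
  · have hV₀ := hV.restrict fun s => ¬j s < (I s).numStates
    set V₀ := V.restrict fun s => ¬j s < (I s).numStates
    refine Computes.sup (V := V₀) (N := fun s => (I s.1).numStates)
      (g := fun s q => indicator ((I s.1).IsTransition (j s.1 % (I s.1).numStates) q) *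
        ((I s.1).numDominated ((I s.1).T - j s.1 / (I s.1).numStates)
          (fun u => (I s.1).digit q u ≠ (I s.1).digit (j s.1 % (I s.1).numStates) u) +
        V.heap s.1 ((I s.1).tableStart +
          ((j s.1 / (I s.1).numStates - 1) * (I s.1).numStates + q))))
      (hV₀.computes_numStates fun s => hH s.1) (hV₀.polyBounded_numStates fun s => hH s.1)
      fun A => ?_
    have hV' := hV₀.loop (fun s => (I s.1).numStates) A
    have hj' := (hj.restrict fun s => ¬j s < (I s).numStates).loop
      (fun s => (I s.1).numStates) A
    have pj' := (pj.restrict fun s => ¬j s < (I s).numStates).loop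
      (fun s => (I s.1).numStates) A
    have hS := hV'.computes_numStates fun s => hH s.1.1
    have hq := V₀.computes_loop_index (fun s => (I s.1).numStates) A
    have pq := polyBounded_loop_index (V := V₀)
      (hV₀.polyBounded_numStates fun s => hH s.1) A
    have hp := hj'.mod hS pj' fun _ => PDSInstance.numStates_pos
    have pp := pj'.of_le (f := fun s => j s.1.1 % (I s.1.1).numStates) fun s => Nat.mod_le _ _
    have hr := hj'.div hS pj' fun _ => PDSInstance.numStates_pos
    have pr := pj'.of_le (f := fun s => j s.1.1 / (I s.1.1).numStates - 1)
      fun s => (Nat.sub_le _ _).trans (Nat.div_le_self _ _)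
    refine Computes.mul (hV'.decides_isTransition (fun s => hH s.1.1) hp pp hq pq)
      ((hV'.computes_numDominated (fun s => hH s.1.1) (hV'.computes_T.sub hr) (fun s => ?_)
        hp pp hq pq).add (Computes.heap (hV'.computes_tableStart.add
          (((hr.sub (computes_const _ 1)).mul hS pr).add hq))))
      ((polyBounded_const _ 1).of_le fun s => indicator_le_one _)
    exact Nat.sub_lt (I s.1.1).one_le_T
      (Nat.div_pos (not_lt.1 s.1.2) PDSInstance.numStates_pos)
  · have hS := (I s).numStates_pos
    have hdm := Nat.div_add_mod (j s) (I s).numStates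
    have hm := Nat.mod_lt (j s) hS
    split_ifs with h
    · unfold PDSInstance.tableEntry
      rw [Nat.div_eq_of_lt h, PDSInstance.value]
    · obtain ⟨r, hr⟩ := Nat.exists_eq_succ_of_ne_zero (Nat.div_pos (not_lt.1 h) hS).ne'
      unfold PDSInstance.tableEntry
      rw [hr, PDSInstance.value]
      refine Finset.sup_congr rfl fun q hq => ?_
      have hq := Finset.mem_range.1 hq
      rw [hh, Nat.succ_eq_add_one, Nat.add_sub_cancel, PDSInstance.tableEntry_mul_add _ hq]
      rw [hr, Nat.mul_succ, mul_comm] at hdm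
      rw [Nat.succ_eq_add_one, Nat.add_sub_cancel]
      omega

theorem computesOverwriting_isYes (hV : V.Over I) :
    V.ComputesOverwriting (fun s => indicator (I s).IsYes) := by
  classical
  refine Computes.overwriting (tab := fun s => (I s).tableEntry) hV.computes_tableSize
    hV.polyBounded_tableSize hV.computes_tableStart ?_ ?_
  · have hV' := (hV.loop (fun s => (I s).tableSize) (fun _ i => i)).withTable
      (fun s => (I s.1).tableEntry) (fun s => s.2) (base := fun s => (I s.1).tableStart)
      fun s => le_rfl
    -- A round of the filling loop exists only if the table is nonempty, which certifies that the
    -- instance is hard.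
    refine hV'.computes_tableEntry (fun s => PDSInstance.isHard_of_lt_tableSize s.2.2)
      (j := fun s => s.2) ?_ (fun s => s.2.2) fun s x hx => ?_
    · refine (View.computes_reg _ (i := V.m) (by simp [View.withTable, View.loop])).congr
        fun s => ?_
      simp [View.withTable, View.loop]
    · simp only [View.withTable]
      rw [if_pos (by omega), Nat.add_sub_cancel_left]
  · have hV' := hV.withTable (fun s => (I s).tableEntry) (fun s => (I s).tableSize)
      (base := fun s => (I s).tableStart) fun s => le_rfl
    set V' := V.withTable (fun s => (I s).tableStart) (fun s => (I s).tableEntry)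
      (fun s => (I s).tableSize) with hV'def
    refine (Computes.ite (p := fun s => (I s).IsHard)
      (f := fun s => indicator (∃ p < (I s).numStates, (I s).t ≤
        V'.heap s ((I s).tableStart + ((I s).T * (I s).numStates + p))))
      (g := fun s => indicator ((I s).t ≤ (I s).n * (I s).T)) hV'.decides_isHard ?_
      ((hV'.computes_t.le (hV'.computes_n.mul hV'.computes_T hV'.polyBounded_n)).restrict _)).congr
      fun s => ?_
    · have hV₀ := hV'.restrict fun s => (I s).IsHard
      refine Decides.bex (V := V'.restrict fun s => (I s).IsHard)
        (p := fun s p => (I s.1).t ≤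
          V'.heap s.1 ((I s.1).tableStart + ((I s.1).T * (I s.1).numStates + p)))
        (hV₀.computes_numStates fun s => s.2) (hV₀.polyBounded_numStates fun s => s.2)
        fun A => ?_
      have hV₁ := hV₀.loop (fun s => (I s.1).numStates) A
      exact hV₁.computes_t.le (Computes.heap (hV₁.computes_tableStart.add
        ((hV₁.computes_T.mul (hV₁.computes_numStates fun s => s.1.2) hV₁.polyBounded_T).add
          (computes_loop_index _ _ A))))
    · split_ifs with h
      · rw [PDSInstance.isYes_iff_value]
        refine congrArg indicator (propext (exists_congr fun p => and_congr_right fun hp => ?_))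
        have h1 := PDSInstance.tableSize_eq h
        rw [Nat.succ_mul] at h1
        have h2 : V'.heap s ((I s).tableStart + ((I s).T * (I s).numStates + p)) =
            (I s).value (I s).T p := by
          simp only [hV'def, View.withTable]
          rw [if_pos (by omega), Nat.add_sub_cancel_left, PDSInstance.tableEntry_mul_add _ hp]
        rw [h2]
      · rw [PDSInstance.isYes_iff_of_not_isHard h]

end Over

/-! ### Making room for registers -/

/-- The view of the memory after the first `K` entries of the adjacency matrices have been packed
into cell `0`. -/
noncomputable def packedInput : View (PDSInstance × ℕ) where
  size s := 2 ^ s.2 * (2 ^ s.1.t * (s.1.n + s.1.T)) + 1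
  rad s := s.2 + 5
  m := 5
  reg s i := if i = 0 then s.1.packed s.2 s.1.n else s.1.encode i
  heap s j := s.1.encode (j + s.2 + 5)
  two_le_size s := Nat.succ_le_succ (Nat.mul_pos (Nat.two_pow_pos _)
    (Nat.mul_pos (Nat.two_pow_pos _) (s.1.one_le_T.trans (Nat.le_add_left _ _))))

theorem packedInput_over : packedInput.Over Prod.fst :=
  ⟨le_rfl, fun _ => rfl, fun _ => rfl, fun _ => rfl, fun _ => rfl, fun _ => rfl,
    fun _ _ _ => rfl, fun _ => rfl⟩

end View

/-- Code that packs the cells `5, …, K + 4` into cell `0`. -/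
def packCode : ℕ → List RAMInstr
  | 0 => []
  | K + 1 => .add 0 0 0 :: .add 0 0 (K + 5) :: packCode K

theorem length_packCode (K : ℕ) : (packCode K).length = 2 * K := by
  induction K with
  | zero => rfl
  | succ K ih =>
    simp only [packCode, List.length_cons, ih]
    omega

theorem iterate_step_packCode {P : RAMProgram} {I : PDSInstance} (K b x : ℕ)
    (hP : P.At b (packCode K)) :
    P.step^[2 * K] ⟨b, Function.update I.encode 0 x⟩ =
      ⟨b + 2 * K, Function.update I.encode 0 (I.packed K x)⟩ := by
  induction K generalizing b x with
  | zero => rfl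
  | succ K ih =>
    obtain ⟨h1, hP⟩ := hP.cons
    obtain ⟨h2, hP⟩ := hP.cons
    have h := ih (b + 1 + 1) (2 * x + I.encode (K + 5)) hP
    rw [show 2 * (K + 1) = 2 + 2 * K by ring, show b + (2 + 2 * K) = b + 1 + 1 + 2 * K by ring]
    refine RAMProgram.iterate_step_trans ?_ h
    simp only [Function.iterate_succ, Function.iterate_zero, Function.comp_apply, id]
    rw [RAMProgram.step_eq h1]
    simp only [RAMInstr.exec]
    rw [RAMProgram.step_eq h2]
    simp [RAMInstr.exec, two_mul]

theorem mainTheorem3 :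
    ∃ (P : RAMProgram) (c : ℕ),
      P.DecidesPDSInTime (fun I => c * 2 ^ (c * I.t) * (I.n + I.T) ^ c) := by
  -- The number of packed entries is a parameter of `packedInput`, so the number `K` of scratch
  -- cells is known before exactly `K` entries are packed to free the cells `5, …, K + 4`.
  obtain ⟨K, hK⟩ := View.packedInput_over.computesOverwriting_isYes
  obtain ⟨l, e, code, hl, hcode⟩ := hK (K + 5) 5 id (fun i hi => hi) (by omega)
  let P : RAMProgram := packCode K ++ (code (2 * K) ++ [.copy 0 5])
  have hP : P.At 0 P := fun j i h => by rwa [Nat.zero_add]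
  -- Packing and the final copy take `2 * K + 1` steps. With `Y = 2 ^ t * (n + T)`, the rest takes
  -- at most `(2 ^ K * Y + 1) ^ e ≤ 2 ^ ((K + 1) * e) * Y ^ e` steps; the last summand accounts for
  -- the exponent `e`.
  refine ⟨P, 2 * K + 1 + 2 ^ ((K + 1) * e) + e, fun I => ?_⟩
  obtain ⟨h1, hP⟩ := hP.append
  rw [length_packCode, Nat.zero_add] at hP
  obtain ⟨h2, hP⟩ := hP.append
  rw [hl] at hP
  have hs₁ := iterate_step_packCode (I := I) K 0 I.n h1
  rw [Nat.zero_add, show I.n = I.encode 0 from rfl, Function.update_eq_self] at hs₁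
  obtain ⟨t, mem, ht, hs₂, hd⟩ := hcode P (2 * K) (I, K)
    (Function.update I.encode 0 (I.packed K (I.encode 0))) h2 (by
    refine ⟨rfl, fun i hi => ?_, fun j => ?_⟩
    · by_cases h : i = 0
      · subst h
        simp [View.packedInput]
        rfl
      · simp [View.packedInput, h]
    · rw [Function.update_of_ne (by omega)]
      simp only [View.packedInput]
      congr 1
      omega)
  refine ⟨2 * K + t + 1, ?_, ?_⟩
  · have hY : 1 ≤ 2 ^ I.t * (I.n + I.T) :=
      Nat.mul_pos (Nat.two_pow_pos _) (I.one_le_T.trans (Nat.le_add_left _ _))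
    set Y := 2 ^ I.t * (I.n + I.T) with hYdef
    have ht : t ≤ (2 ^ K * Y + 1) ^ e := ht
    have h3 : 2 ^ K * Y + 1 ≤ 2 ^ (K + 1) * Y := by
      have := Nat.mul_pos (Nat.two_pow_pos K) hY
      rw [pow_succ, mul_comm _ 2, mul_assoc]
      omega
    have h4 : t ≤ 2 ^ ((K + 1) * e) * Y ^ e := by
      rw [pow_mul, ← mul_pow]
      exact ht.trans (Nat.pow_le_pow_left h3 e)
    have h5 : 1 ≤ Y ^ e := Nat.one_le_pow _ _ hY
    have h6 : (I.n + I.T) ^ e ≤ (I.n + I.T) ^ (2 * K + 1 + 2 ^ ((K + 1) * e) + e) :=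
      Nat.pow_le_pow_right (I.one_le_T.trans (Nat.le_add_left _ _)) (Nat.le_add_left _ _)
    have h7 : 2 ^ (e * I.t) ≤ 2 ^ ((2 * K + 1 + 2 ^ ((K + 1) * e) + e) * I.t) :=
      Nat.pow_le_pow_right two_pos (Nat.mul_le_mul_right _ (Nat.le_add_left _ _))
    have h8 : Y ^ e = 2 ^ (e * I.t) * (I.n + I.T) ^ e := by
      rw [hYdef, mul_pow, ← pow_mul, mul_comm I.t]
    calc 2 * K + t + 1 ≤ (2 * K + 1 + 2 ^ ((K + 1) * e)) * Y ^ e := by nlinarith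
      _ ≤ (2 * K + 1 + 2 ^ ((K + 1) * e) + e) * Y ^ e :=
        Nat.mul_le_mul_right _ (Nat.le_add_right _ _)
      _ ≤ _ := by
        rw [h8, ← mul_assoc]
        exact Nat.mul_le_mul (Nat.mul_le_mul_left _ h7) h6
  · have hfin : P.step^[2 * K + t + 1] ⟨0, I.encode⟩ =
        ⟨2 * K + l + 1, Function.update mem 0 (mem 5)⟩ := by
      refine RAMProgram.iterate_step_trans (RAMProgram.iterate_step_trans hs₁ hs₂) ?_
      rw [Function.iterate_one, RAMProgram.step_eq hP.cons.1]
      rfl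
    rw [hfin]
    refine ⟨?_, ?_⟩
    · simp [P, length_packCode, hl]
      omega
    · dsimp only
      rw [Function.update_self, hd]
      dsimp only
      unfold indicator
      split_ifs <;> rfl
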